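/- Let $n\ge 0$. All matrices are real $n\times n$ matrices and $*$ is transposition. Let $B$ be the group of invertible upper triangular matrices, $B^*$ the group of invertible lower triangular matrices, and $B^+\subset B$ the subgroup of matrices with positive diagonal. Let $G=\{g : g^*g=1,\ g^2=1\}$ be the space of orthogonal involutions, i.e. the Grassmannian of all linear subspaces of $\mathbb R^n$, each identified with the reflection across it. Let $\tilde v$ be a signed permutation matrix, $\tilde v e_i=\epsilon_i e_{v(i)}$ with a permutation $v$ and signs $\epsilon_i\in\{\pm1\}$, such that $\tilde v^2=1$. Let $\mathfrak A_{\tilde v}$ be the space of symmetric positive definite matrices $A$ with $\tilde v^{-1}A\tilde v=A$, with $A_{i,i}=1$ for all $i$, and with $A_{i,j}=0$ whenever $i<j$ and $v(i)<v(j)$. For an involution $Z$ put $\pi(Z)=\theta Z\theta^{-1}$, where $\theta\in B^+$ is the Cholesky factor given by $\theta^*\theta=1+Z^*Z$. For $A\in\mathfrak A_{\tilde v}$ and $g\in G$ put $$\chi(A,g)=\psi g\psi^{-1},\qquad \psi\in B^+,\quad \psi^*\psi=A+gAg .$$ **Theorem.** (1) For all $A\in\mathfrak A_{\tilde v}$ and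 $g\in G$ there are unique $\psi,\alpha\in B^+$ with $\psi^*\psi=A+gAg$ and $\alpha^*\alpha=A$; moreover $\chi(A,g)=\pi(\alpha g\alpha^{-1})$ and $\chi(A,g)\in G$. (2) There are integers $a,b\ge 0$ such that $\mathfrak A_{\tilde v}$ near $1$, $G\cap B^*vB$ near $\tilde v$, and $G$ near $\tilde v$ are embedded smooth submanifolds of the space of matrices, of dimensions $a$, $b$ and $a+b$ respectively. (3) The restriction of $\chi$ to $\mathfrak A_{\tilde v}\times(G\cap B^*vB)$ is a local diffeomorphism near $(1,\tilde v)$, and gives a local product decomposition of $G$ near $\tilde v$: one has $\chi(1,\tilde v)=\tilde v$, and there are open neighbourhoods $U$ of $1$ in $\mathfrak A_{\tilde v}$, $V$ of $\tilde v$ in $G\cap B^*vB$ and $W$ of $\tilde v$ in $G$ such that $\chi$ maps $U\times V$ diffeomorphically onto $W$. This decomposition is compatible with the Bruhat cells: if $C$ is any double coset $BwB$ ($w$ a permutation matrix) or $B^+\tilde wB^+$ ($\tilde w$ a signed permutation matrix), or the closure of such a double coset in the space of matrices, then $\chi\big(U\times(V\cap C)\big)=W\cap C$. -/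

import Mathlib

open scoped Matrix ContDiff

attribute [local instance] Matrix.normedAddCommGroup Matrix.normedSpace

noncomputable section

/-! ### Smooth maps between subsets of normed spaces -/

section Smooth

variable {E F : Type*} [NormedAddCommGroup E] [NormedSpace ℝ E]
  [NormedAddCommGroup F] [NormedSpace ℝ F]

/-- `U` is an open subset of the subspace `S`. -/
def IsOpenIn {X : Type*} [TopologicalSpace X] (U S : Set X) : Prop :=
  ∃ O : Set X, IsOpen O ∧ U = S ∩ O

/-- A map on an arbitrary subset `S` of a normed space is smooth if near every point of `S` it is
the restriction of a `C^∞` map defined on an open set of the ambient space. -/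
def SmoothOnSet (f : E → F) (S : Set E) : Prop :=
  ∀ x ∈ S, ∃ (O : Set E) (f' : E → F),
    IsOpen O ∧ x ∈ O ∧ ContDiffOn ℝ ∞ f' O ∧ Set.EqOn f f' (S ∩ O)

/-- `f` restricts to a diffeomorphism of `S` onto `T`: a smooth bijection with smooth inverse. -/
def IsDiffeoOnSet (f : E → F) (S : Set E) (T : Set F) : Prop :=
  Set.BijOn f S T ∧ SmoothOnSet f S ∧
    ∃ h : F → E, Set.InvOn h f S T ∧ SmoothOnSet h T

/-- Near its point `x` the set `S` is an embedded smooth submanifold of dimension `d`: a smooth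
chart of the ambient space around `x` flattens `S` to a linear subspace of dimension `d`. -/
def IsSubmanifoldAt (S : Set E) (x : E) (d : ℕ) : Prop :=
  x ∈ S ∧ ∃ (Φ : OpenPartialHomeomorph E E) (L : Submodule ℝ E),
    x ∈ Φ.source ∧ ContDiffOn ℝ ∞ Φ Φ.source ∧ ContDiffOn ℝ ∞ Φ.symm Φ.target ∧
    Module.finrank ℝ L = d ∧ Φ '' (S ∩ Φ.source) = (L : Set E) ∩ Φ.target

end Smooth

/-! ### Bruhat cells of the Grassmannian -/

/-- The invertible upper triangular matrices `B`. -/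
def upperB (n : ℕ) : Set (Matrix (Fin n) (Fin n) ℝ) :=
  {b | (∀ i j, j < i → b i j = 0) ∧ IsUnit b.det}

/-- The upper triangular matrices with positive diagonal `B⁺`. -/
def upperBPos (n : ℕ) : Set (Matrix (Fin n) (Fin n) ℝ) :=
  {b | (∀ i j, j < i → b i j = 0) ∧ ∀ i, 0 < b i i}

/-- The signed permutation matrix with `e_i ↦ ε_i e_{w(i)}`. -/
def signedPerm {n : ℕ} (w : Equiv.Perm (Fin n)) (ε : Fin n → ℤˣ) : Matrix (Fin n) (Fin n) ℝ :=
  Matrix.of fun r c => if r = w c then ((ε c : ℤ) : ℝ) else 0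

/-- The permutation matrix with `e_i ↦ e_{w(i)}`. -/
def permMat {n : ℕ} (w : Equiv.Perm (Fin n)) : Matrix (Fin n) (Fin n) ℝ :=
  signedPerm w fun _ => 1

/-- The Bruhat double coset `B w B`. -/
def bruhat {n : ℕ} (w : Equiv.Perm (Fin n)) : Set (Matrix (Fin n) (Fin n) ℝ) :=
  {g | ∃ b ∈ upperB n, ∃ c ∈ upperB n, g = b * permMat w * c}

/-- The signed Bruhat double coset `B⁺ w̃ B⁺`. -/
def signedBruhat {n : ℕ} (w : Equiv.Perm (Fin n)) (ε : Fin n → ℤˣ) :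
    Set (Matrix (Fin n) (Fin n) ℝ) :=
  {g | ∃ b ∈ upperBPos n, ∃ c ∈ upperBPos n, g = b * signedPerm w ε * c}

/-- The opposite double coset `B* v B`, where `B*` are the lower triangular matrices. -/
def oppBruhat {n : ℕ} (v : Equiv.Perm (Fin n)) : Set (Matrix (Fin n) (Fin n) ℝ) :=
  {g | ∃ b ∈ upperB n, ∃ c ∈ upperB n, g = bᵀ * permMat v * c}

/-- The Grassmannian of all linear subspaces of `ℝⁿ`, as the space of orthogonal involutions
(a subspace corresponds to the reflection across it). -/
def grassm (n : ℕ) : Set (Matrix (Fin n) (Fin n) ℝ) :=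
  {g | gᵀ * g = 1 ∧ g * g = 1}

/-- The transversal slice `G ∩ B* v B`. -/
def slice {n : ℕ} (v : Equiv.Perm (Fin n)) : Set (Matrix (Fin n) (Fin n) ℝ) :=
  grassm n ∩ oppBruhat v

/-- The space `𝔄_ṽ` of normalized `ṽ`-invariant symmetric positive definite matrices. -/
def normForms {n : ℕ} (v : Equiv.Perm (Fin n)) (ε : Fin n → ℤˣ) :
    Set (Matrix (Fin n) (Fin n) ℝ) :=
  {A | A.PosDef ∧ (signedPerm v ε)⁻¹ * A * signedPerm v ε = A ∧ (∀ i, A i i = 1) ∧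
    ∀ i j, i < j → v i < v j → A i j = 0}

open Classical in
/-- The Cholesky factor of `M`: the matrix `ψ ∈ B⁺` with `ψ* ψ = M` (and `1` if there is none). -/
def cholesky {n : ℕ} (M : Matrix (Fin n) (Fin n) ℝ) : Matrix (Fin n) (Fin n) ℝ :=
  if h : ∃ ψ, ψ ∈ upperBPos n ∧ ψᵀ * ψ = M then h.choose else 1

/-- The projection of the involutions onto the orthogonal involutions,
`Z ↦ θ Z θ⁻¹` with `θ ∈ B⁺` and `θ* θ = 1 + Z* Z`. -/
def orthoProj {n : ℕ} (Z : Matrix (Fin n) (Fin n) ℝ) : Matrix (Fin n) (Fin n) ℝ :=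
  cholesky (1 + Zᵀ * Z) * Z * (cholesky (1 + Zᵀ * Z))⁻¹

/-- The map `χ(A, g) = ψ g ψ⁻¹` with `ψ ∈ B⁺` and `ψ* ψ = A + g A g`. -/
def chi {n : ℕ} (p : Matrix (Fin n) (Fin n) ℝ × Matrix (Fin n) (Fin n) ℝ) :
    Matrix (Fin n) (Fin n) ℝ :=
  cholesky (p.1 + p.2 * p.1 * p.2) * p.2 * (cholesky (p.1 + p.2 * p.1 * p.2))⁻¹

end

/-! Since g² = 1, conjugation by g swaps the summands of A + gAg, so g commutes with this form and
ψgψ⁻¹ is again an orthogonal involution. As a conjugate of g by an element of B⁺, χ(A,g) lies in a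
set stable under B⁺-conjugation exactly when g does (`chi_image_inter`), and closures of stable sets
are stable. Compatibility with the Bruhat cells thus follows formally from χ(U × V) = W; the
substance is the local diffeomorphism.

Write g = ṽh and let `twist` be X ↦ ṽXᵀṽ. Then g ∈ G iff h is orthogonal and fixed by the twist, so
G has tangent space ṽT at ṽ, where T consists of the skew matrices fixed by the twist. Call (i,j) a
lower inversion if j < i and v(i) < v(j). The slice has tangent space ṽS, where S ⊆ T consists of
the matrices vanishing at the lower inversions, and near 1 the space 𝔄_ṽ is an open part of the
affine space of all 1 + c + cᵀ with c twist-fixed and supported on the lower inversions. The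
derivative of χ at (1,ṽ) sends (c + cᵀ, ṽZ) to ṽ(c - cᵀ + Z) (`hasDerivAt_conjMap`): to first order
the variation of g drops out of A + gAg, and the Cholesky factor of (A + gAg)/2 moves by cᵀ. As T is
the direct sum of S and the matrices c - cᵀ, this derivative is bijective.

All smooth arguments take place in the ambient matrix space, through the inverse function theorem
for maps with identity derivative. `exists_chart` flattens G to T and the slice to S at once: the
Cayley transform linearizes G, and is corrected by the map κ of `exists_cell_coordinates`, which
comes from factoring matrices near 1 in (ṽB*ṽ)(1 + c)B and vanishes exactly on the opposite cell.
`exists_product_decomposition` reads χ in this chart as a map on T, extends it to all matrices by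
the identity on the kernel of the projection to T, and inverts the extension. -/

noncomputable section

/-! ### Triangular matrices -/

section Triangular

variable {n : ℕ}

theorem upperBPos_subset_upperB : upperBPos n ⊆ upperB n := by
  rintro b ⟨hb, hd⟩
  refine ⟨hb, ?_⟩
  have : Matrix.BlockTriangular b id := fun i j h => hb i j h
  rw [Matrix.det_of_isUpperTriangular this]
  exact IsUnit.mk0 _ (Finset.prod_ne_zero_iff.2 fun i _ => (hd i).ne')

theorem isUnit_det_of_mem_upperBPos {b : Matrix (Fin n) (Fin n) ℝ} (hb : b ∈ upperBPos n) :
    IsUnit b.det :=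
  (upperBPos_subset_upperB hb).2

theorem diag_ne_zero_of_mem_upperB {b : Matrix (Fin n) (Fin n) ℝ} (hb : b ∈ upperB n) (i : Fin n) :
    b i i ≠ 0 := by
  have : Matrix.BlockTriangular b id := fun i j h => hb.1 i j h
  have h := hb.2
  rw [Matrix.det_of_isUpperTriangular this] at h
  exact Finset.prod_ne_zero_iff.1 h.ne_zero i (Finset.mem_univ i)

theorem mul_apply_diag_of_upper {b c : Matrix (Fin n) (Fin n) ℝ} (hb : ∀ i j, j < i → b i j = 0)
    (hc : ∀ i j, j < i → c i j = 0) (i : Fin n) : (b * c) i i = b i i * c i i := by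
  rw [Matrix.mul_apply, Finset.sum_eq_single i]
  · intro k _ hk
    rcases lt_or_gt_of_ne hk with h | h
    · rw [hb i k h, zero_mul]
    · rw [hc k i h, mul_zero]
  · simp

theorem mul_mem_upperB {b c : Matrix (Fin n) (Fin n) ℝ} (hb : b ∈ upperB n) (hc : c ∈ upperB n) :
    b * c ∈ upperB n := by
  refine ⟨fun i j h => ?_, by rw [Matrix.det_mul]; exact hb.2.mul hc.2⟩
  have h1 : Matrix.BlockTriangular b id := fun i j h => hb.1 i j h
  have h2 : Matrix.BlockTriangular c id := fun i j h => hc.1 i j h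
  exact h1.mul h2 h

theorem inv_mem_upperB {b : Matrix (Fin n) (Fin n) ℝ} (hb : b ∈ upperB n) : b⁻¹ ∈ upperB n := by
  refine ⟨fun i j h => ?_, Matrix.isUnit_nonsing_inv_det _ hb.2⟩
  have h1 : Matrix.BlockTriangular b id := fun i j h => hb.1 i j h
  let _ := Matrix.invertibleOfIsUnitDet b hb.2
  exact Matrix.blockTriangular_inv_of_blockTriangular h1 h

theorem mul_mem_upperBPos {b c : Matrix (Fin n) (Fin n) ℝ} (hb : b ∈ upperBPos n)
    (hc : c ∈ upperBPos n) : b * c ∈ upperBPos n := by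
  refine ⟨(mul_mem_upperB (upperBPos_subset_upperB hb) (upperBPos_subset_upperB hc)).1, fun i => ?_⟩
  rw [mul_apply_diag_of_upper hb.1 hc.1]
  exact mul_pos (hb.2 i) (hc.2 i)

theorem inv_mem_upperBPos {b : Matrix (Fin n) (Fin n) ℝ} (hb : b ∈ upperBPos n) :
    b⁻¹ ∈ upperBPos n := by
  have h := inv_mem_upperB (upperBPos_subset_upperB hb)
  refine ⟨h.1, fun i => ?_⟩
  have h1 := mul_apply_diag_of_upper hb.1 h.1 i
  rw [Matrix.mul_nonsing_inv _ (isUnit_det_of_mem_upperBPos hb), Matrix.one_apply_eq] at h1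
  have := hb.2 i
  by_contra! hcon
  nlinarith [mul_nonneg this.le (neg_nonneg.2 hcon)]

/-- A symmetric positive definite matrix has at most one Cholesky factor. -/
theorem eq_of_transpose_mul_self_eq {b c : Matrix (Fin n) (Fin n) ℝ} (hb : b ∈ upperBPos n)
    (hc : c ∈ upperBPos n) (h : bᵀ * b = cᵀ * c) : b = c := by
  have hbu := isUnit_det_of_mem_upperBPos hb
  have hcu := isUnit_det_of_mem_upperBPos hc
  have hq := mul_mem_upperBPos hb (inv_mem_upperBPos hc)
  set q := b * c⁻¹ with hqdef
  have hbq : b = q * c := by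
    rw [hqdef, Matrix.mul_assoc, Matrix.nonsing_inv_mul _ hcu, Matrix.mul_one]
  have hqq : qᵀ * q = 1 := by
    rw [hqdef, Matrix.transpose_mul, Matrix.mul_assoc, ← Matrix.mul_assoc bᵀ, h,
      Matrix.transpose_nonsing_inv, Matrix.mul_assoc, Matrix.mul_nonsing_inv _ hcu, Matrix.mul_one,
      Matrix.nonsing_inv_mul _ (by rwa [Matrix.det_transpose])]
  have hqt : q⁻¹ = qᵀ := Matrix.inv_eq_left_inv hqq
  have hqi := inv_mem_upperBPos hq
  rw [hqt] at hqi
  -- The inverse of the orthogonal matrix q is its transpose, so q is both upper and lower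
  -- triangular; its positive diagonal entries have square 1.
  have hq1 : q = 1 := by
    ext i j
    rcases lt_trichotomy i j with hij | rfl | hij
    · have := hqi.1 j i hij
      rw [Matrix.one_apply_ne hij.ne]
      exact this
    · have h1 := mul_apply_diag_of_upper hqi.1 hq.1 i
      rw [hqq, Matrix.transpose_apply, Matrix.one_apply_eq] at h1
      rw [Matrix.one_apply_eq]
      nlinarith [hq.2 i]
    · rw [hq.1 i j hij, Matrix.one_apply_ne hij.ne']
  rw [hbq, hq1, Matrix.one_mul]

theorem exists_cholesky {M : Matrix (Fin n) (Fin n) ℝ} (hM : M.PosDef) :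
    ∃ ψ, ψ ∈ upperBPos n ∧ ψᵀ * ψ = M := by
  set L := LDL.lower hM with hL
  have hLow : ∀ i j, i < j → L i j = 0 := by
    intro i j hij
    have h1 : Matrix.BlockTriangular (LDL.lowerInv hM) OrderDual.toDual :=
      fun i j h => LDL.lowerInv_triangular hM h
    exact Matrix.blockTriangular_inv_of_blockTriangular h1 hij
  have hLdet : IsUnit L.det :=
    Matrix.isUnit_nonsing_inv_det _ (Matrix.isUnit_det_of_invertible (LDL.lowerInv hM))
  have hLt : Lᵀ ∈ upperB n := ⟨fun i j h => hLow j i h, by rwa [Matrix.det_transpose]⟩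
  have hLd : ∀ i, L i i ≠ 0 := fun i => diag_ne_zero_of_mem_upperB hLt i
  have hLDL : L * LDL.diag hM * Lᵀ = M := by
    have := LDL.lower_conj_diag hM
    rwa [Matrix.conjTranspose_eq_transpose_of_trivial] at this
  have hpos : ∀ i, 0 < LDL.diagEntries hM i := by
    intro i
    have h1 : (LDL.diag hM).PosDef := by
      rw [LDL.diag_eq_lowerInv_conj]
      refine hM.mul_mul_conjTranspose_same ?_
      exact Matrix.vecMul_injective_of_isUnit (isUnit_of_invertible _)
    rw [LDL.diag, Matrix.posDef_diagonal_iff] at h1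
    exact h1 i
  -- The square root turns LDLᵀ into a Cholesky factorization; the signs make the diagonal of the
  -- factor positive without changing d i * d i.
  set d : Fin n → ℝ := fun i => SignType.sign (L i i) * Real.sqrt (LDL.diagEntries hM i) with hd
  have hdd : ∀ i, d i * d i = LDL.diagEntries hM i := by
    intro i
    have h2 := Real.mul_self_sqrt (hpos i).le
    rcases lt_or_gt_of_ne (hLd i) with h | h
    · simp [hd, sign_neg h, h2]
    · simp [hd, sign_pos h, h2]
  refine ⟨Matrix.diagonal d * Lᵀ, ⟨fun i j h => ?_, fun i => ?_⟩, ?_⟩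
  · rw [Matrix.diagonal_mul, Matrix.transpose_apply, hLow j i h, mul_zero]
  · rw [Matrix.diagonal_mul, Matrix.transpose_apply]
    have h2 := Real.sqrt_pos.2 (hpos i)
    rcases lt_or_gt_of_ne (hLd i) with h | h
    · simp only [hd, sign_neg h]
      simp only [SignType.coe_neg, SignType.coe_one]
      nlinarith
    · simp only [hd, sign_pos h]
      simp only [SignType.coe_one, one_mul]
      positivity
  · rw [Matrix.transpose_mul, Matrix.transpose_transpose, Matrix.diagonal_transpose,
      Matrix.mul_assoc, ← Matrix.mul_assoc (Matrix.diagonal d), Matrix.diagonal_mul_diagonal,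
      ← Matrix.mul_assoc]
    simp only [hdd]
    exact hLDL

theorem cholesky_spec {M : Matrix (Fin n) (Fin n) ℝ} (hM : M.PosDef) :
    cholesky M ∈ upperBPos n ∧ (cholesky M)ᵀ * cholesky M = M := by
  rw [cholesky, dif_pos (exists_cholesky hM)]
  exact (exists_cholesky hM).choose_spec

theorem cholesky_eq {M ψ : Matrix (Fin n) (Fin n) ℝ} (hψ : ψ ∈ upperBPos n) (h : ψᵀ * ψ = M) :
    cholesky M = ψ := by
  have hex : ∃ ψ, ψ ∈ upperBPos n ∧ ψᵀ * ψ = M := ⟨ψ, hψ, h⟩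
  rw [cholesky, dif_pos hex]
  exact eq_of_transpose_mul_self_eq hex.choose_spec.1 hψ (hex.choose_spec.2.trans h.symm)

theorem existsUnique_cholesky {M : Matrix (Fin n) (Fin n) ℝ} (hM : M.PosDef) :
    ∃! ψ, ψ ∈ upperBPos n ∧ ψᵀ * ψ = M :=
  ⟨cholesky M, cholesky_spec hM, fun _ h => (cholesky_eq h.1 h.2).symm⟩

end Triangular

/-! ### The map `chi` -/

section Chi

variable {n : ℕ}

theorem transpose_eq_of_mem_grassm {g : Matrix (Fin n) (Fin n) ℝ} (hg : g ∈ grassm n) : gᵀ = g := by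
  rw [← Matrix.mul_one gᵀ, ← hg.2, ← Matrix.mul_assoc, hg.1, Matrix.one_mul]

theorem posDef_add_conj {A g : Matrix (Fin n) (Fin n) ℝ} (hA : A.PosDef) (hg : g ∈ grassm n) :
    (A + g * A * g).PosDef := by
  have h := hA.posSemidef.conjTranspose_mul_mul_same g
  rw [Matrix.conjTranspose_eq_transpose_of_trivial, transpose_eq_of_mem_grassm hg] at h
  exact hA.add_posSemidef h

/-- Conjugating an orthogonal involution `g` by `ψ` gives an orthogonal involution if `g` preserves
the quadratic form `ψᵀ * ψ`. -/
theorem conj_mem_grassm {ψ g : Matrix (Fin n) (Fin n) ℝ} (hψ : IsUnit ψ.det) (hg : g ∈ grassm n)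
    (h : g * (ψᵀ * ψ) = ψᵀ * ψ * g) : ψ * g * ψ⁻¹ ∈ grassm n := by
  have h2 : (ψ * g * ψ⁻¹) * (ψ * g * ψ⁻¹) = 1 := by
    calc (ψ * g * ψ⁻¹) * (ψ * g * ψ⁻¹) = ψ * g * (ψ⁻¹ * ψ) * g * ψ⁻¹ := by
          simp only [Matrix.mul_assoc]
      _ = ψ * (g * g) * ψ⁻¹ := by
          rw [Matrix.nonsing_inv_mul _ hψ, Matrix.mul_one]; simp only [Matrix.mul_assoc]
      _ = 1 := by rw [hg.2, Matrix.mul_one, Matrix.mul_nonsing_inv _ hψ]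
  have hψt : IsUnit ψᵀ.det := by rwa [Matrix.det_transpose]
  have ht : (ψ * g * ψ⁻¹)ᵀ = ψ * g * ψ⁻¹ := by
    rw [Matrix.transpose_mul, Matrix.transpose_mul, transpose_eq_of_mem_grassm hg,
      Matrix.transpose_nonsing_inv]
    calc (ψᵀ)⁻¹ * (g * ψᵀ) = (ψᵀ)⁻¹ * (g * (ψᵀ * ψ)) * ψ⁻¹ := by
          simp only [Matrix.mul_assoc]
          rw [Matrix.mul_nonsing_inv _ hψ, Matrix.mul_one]
      _ = ((ψᵀ)⁻¹ * ψᵀ) * ψ * g * ψ⁻¹ := by rw [h]; simp only [Matrix.mul_assoc]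
      _ = ψ * g * ψ⁻¹ := by rw [Matrix.nonsing_inv_mul _ hψt, Matrix.one_mul]
  exact ⟨by rw [ht, h2], h2⟩

/-- Conjugation by g exchanges the two summands because g² = 1. -/
theorem comm_add_conj {A g : Matrix (Fin n) (Fin n) ℝ} (hg : g ∈ grassm n) :
    g * (A + g * A * g) = (A + g * A * g) * g := by
  have h : ∀ X, g * (g * X) = X := fun X => by rw [← Matrix.mul_assoc, hg.2, Matrix.one_mul]
  rw [mul_add, add_mul]
  simp only [Matrix.mul_assoc, h, hg.2, Matrix.mul_one]
  rw [add_comm]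

theorem chi_mem_grassm {A g : Matrix (Fin n) (Fin n) ℝ} (hA : A.PosDef) (hg : g ∈ grassm n) :
    chi (A, g) ∈ grassm n := by
  obtain ⟨h1, h2⟩ := cholesky_spec (posDef_add_conj hA hg)
  refine conj_mem_grassm (isUnit_det_of_mem_upperBPos h1) hg ?_
  rw [h2]
  exact comm_add_conj hg

theorem chi_eq_orthoProj {A g : Matrix (Fin n) (Fin n) ℝ} (hA : A.PosDef) (hg : g ∈ grassm n) :
    chi (A, g) = orthoProj (cholesky A * g * (cholesky A)⁻¹) := by
  obtain ⟨h1, h2⟩ := cholesky_spec (posDef_add_conj hA hg)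
  obtain ⟨h3, h4⟩ := cholesky_spec hA
  have hu := isUnit_det_of_mem_upperBPos h3
  have hg' := transpose_eq_of_mem_grassm hg
  set α := cholesky A with hα
  have hut : IsUnit αᵀ.det := by rwa [Matrix.det_transpose]
  set ψ := cholesky (A + g * A * g) with hψ
  -- With Z = αgα⁻¹ one has 1 + ZᵀZ = (αᵀ)⁻¹(A + gAg)α⁻¹, so uniqueness of the Cholesky factor
  -- identifies θ with ψα⁻¹, and θZθ⁻¹ = ψgψ⁻¹.
  have hθ : cholesky (1 + (α * g * α⁻¹)ᵀ * (α * g * α⁻¹)) = ψ * α⁻¹ := by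
    refine cholesky_eq (mul_mem_upperBPos h1 (inv_mem_upperBPos h3)) ?_
    have e1 : (ψ * α⁻¹)ᵀ * (ψ * α⁻¹) = (αᵀ)⁻¹ * (ψᵀ * ψ) * α⁻¹ := by
      rw [Matrix.transpose_mul, Matrix.transpose_nonsing_inv]; simp only [Matrix.mul_assoc]
    have e2 : (α * g * α⁻¹)ᵀ * (α * g * α⁻¹) = (αᵀ)⁻¹ * (g * (αᵀ * α) * g) * α⁻¹ := by
      rw [Matrix.transpose_mul, Matrix.transpose_mul, Matrix.transpose_nonsing_inv, hg']
      simp only [Matrix.mul_assoc]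
    have e3 : (αᵀ)⁻¹ * (αᵀ * α) * α⁻¹ = 1 := by
      rw [← Matrix.mul_assoc, Matrix.nonsing_inv_mul _ hut, Matrix.one_mul,
        Matrix.mul_nonsing_inv _ hu]
    rw [e1, e2, h2, ← e3, h4, mul_add, add_mul]
  rw [orthoProj, hθ, Matrix.mul_inv_rev, Matrix.nonsing_inv_nonsing_inv _ hu]
  change ψ * g * ψ⁻¹ = _
  calc ψ * g * ψ⁻¹ = ψ * (α⁻¹ * α) * g * (α⁻¹ * α) * ψ⁻¹ := by
        rw [Matrix.nonsing_inv_mul _ hu, Matrix.mul_one, Matrix.mul_one]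
    _ = _ := by simp only [Matrix.mul_assoc]

end Chi

/-! ### Invariance of the Bruhat cells -/

section Cells

variable {n : ℕ}

/-- A set of matrices is stable under conjugation by `B⁺`. -/
def IsConjStable (C : Set (Matrix (Fin n) (Fin n) ℝ)) : Prop :=
  ∀ b ∈ upperBPos n, ∀ g ∈ C, b * g * b⁻¹ ∈ C

theorem isConjStable_bruhat (w : Equiv.Perm (Fin n)) : IsConjStable (bruhat w) := by
  rintro b hb _ ⟨x, hx, y, hy, rfl⟩
  refine ⟨b * x, mul_mem_upperB (upperBPos_subset_upperB hb) hx, y * b⁻¹,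
    mul_mem_upperB hy (inv_mem_upperB (upperBPos_subset_upperB hb)), ?_⟩
  simp only [Matrix.mul_assoc]

theorem isConjStable_signedBruhat (w : Equiv.Perm (Fin n)) (δ : Fin n → ℤˣ) :
    IsConjStable (signedBruhat w δ) := by
  rintro b hb _ ⟨x, hx, y, hy, rfl⟩
  refine ⟨b * x, mul_mem_upperBPos hb hx, y * b⁻¹, mul_mem_upperBPos hy (inv_mem_upperBPos hb), ?_⟩
  simp only [Matrix.mul_assoc]

theorem IsConjStable.closure {C : Set (Matrix (Fin n) (Fin n) ℝ)} (hC : IsConjStable C) :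
    IsConjStable (closure C) := by
  intro b hb g hg
  have hcont : Continuous fun g : Matrix (Fin n) (Fin n) ℝ => b * g * b⁻¹ := by fun_prop
  exact map_mem_closure (f := fun g : Matrix (Fin n) (Fin n) ℝ => b * g * b⁻¹) hcont hg
    fun x hx => hC b hb x hx

theorem IsConjStable.conj_mem_iff {C : Set (Matrix (Fin n) (Fin n) ℝ)} (hC : IsConjStable C)
    {b g : Matrix (Fin n) (Fin n) ℝ} (hb : b ∈ upperBPos n) : b * g * b⁻¹ ∈ C ↔ g ∈ C := by
  refine ⟨fun h => ?_, hC b hb g⟩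
  have h1 := hC _ (inv_mem_upperBPos hb) _ h
  have hu := isUnit_det_of_mem_upperBPos hb
  rwa [Matrix.nonsing_inv_nonsing_inv _ hu, Matrix.mul_assoc, Matrix.mul_assoc (b * g),
    Matrix.nonsing_inv_mul _ hu, Matrix.mul_one, ← Matrix.mul_assoc, Matrix.nonsing_inv_mul _ hu,
    Matrix.one_mul] at h1

/-- The conjugating matrix ψ lies in B⁺, so χ(A,g) ∈ C iff g ∈ C. No smoothness or injectivity of χ
enters. -/
theorem chi_image_inter {C : Set (Matrix (Fin n) (Fin n) ℝ)} (hC : IsConjStable C)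
    {U V W : Set (Matrix (Fin n) (Fin n) ℝ)} (hU : ∀ A ∈ U, A.PosDef) (hV : V ⊆ grassm n)
    (h : chi '' (U ×ˢ V) = W) : chi '' (U ×ˢ (V ∩ C)) = W ∩ C := by
  have key : ∀ A ∈ U, ∀ g ∈ V, (chi (A, g) ∈ C ↔ g ∈ C) := fun A hA g hg =>
    hC.conj_mem_iff (cholesky_spec (posDef_add_conj (hU A hA) (hV hg))).1
  subst h
  ext w
  constructor
  · rintro ⟨⟨A, g⟩, ⟨hA, hg, hgC⟩, rfl⟩
    exact ⟨⟨(A, g), ⟨hA, hg⟩, rfl⟩, (key A hA g hg).2 hgC⟩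
  · rintro ⟨⟨⟨A, g⟩, ⟨hA, hg⟩, rfl⟩, hwC⟩
    exact ⟨(A, g), ⟨hA, hg, (key A hA g hg).1 hwC⟩, rfl⟩

end Cells

/-! ### Calculus of matrix-valued maps -/

section MatrixCalculus

variable {n : ℕ} {X : Type*} [NormedAddCommGroup X] [NormedSpace ℝ X]

theorem contDiff_matrix_iff {f : X → Matrix (Fin n) (Fin n) ℝ} :
    ContDiff ℝ ∞ f ↔ ∀ i j, ContDiff ℝ ∞ fun x => f x i j := by
  refine Iff.trans (contDiff_pi (𝕜 := ℝ) (n := ∞) (F' := fun _ : Fin n => Fin n → ℝ) (Φ := f)) ?_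
  exact forall_congr' fun i => contDiff_pi

theorem contDiff_matrix_apply (i j : Fin n) :
    ContDiff ℝ ∞ fun M : Matrix (Fin n) (Fin n) ℝ => M i j :=
  contDiff_matrix_iff.1 contDiff_id i j

theorem contDiff_matrix_mul :
    ContDiff ℝ ∞ fun p : Matrix (Fin n) (Fin n) ℝ × Matrix (Fin n) (Fin n) ℝ => p.1 * p.2 := by
  refine contDiff_matrix_iff.2 fun i j => ?_
  simp only [Matrix.mul_apply]
  exact ContDiff.sum fun k _ => ((contDiff_matrix_apply i k).comp contDiff_fst).mul
    ((contDiff_matrix_apply k j).comp contDiff_snd)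

theorem ContDiffOn.matrixMul {f g : X → Matrix (Fin n) (Fin n) ℝ} {s : Set X}
    (hf : ContDiffOn ℝ ∞ f s) (hg : ContDiffOn ℝ ∞ g s) :
    ContDiffOn ℝ ∞ (fun x => f x * g x) s :=
  contDiff_matrix_mul.comp_contDiffOn (hf.prodMk hg)

theorem ContDiff.matrixMul {f g : X → Matrix (Fin n) (Fin n) ℝ}
    (hf : ContDiff ℝ ∞ f) (hg : ContDiff ℝ ∞ g) : ContDiff ℝ ∞ (fun x => f x * g x) :=
  contDiff_matrix_mul.comp (hf.prodMk hg)

theorem contDiff_matrix_det : ContDiff ℝ ∞ fun M : Matrix (Fin n) (Fin n) ℝ => M.det := by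
  simp only [Matrix.det_apply']
  exact ContDiff.sum fun σ _ => contDiff_const.mul
    (contDiff_prod fun i _ => contDiff_matrix_apply _ _)

theorem contDiff_matrix_adjugate :
    ContDiff ℝ ∞ fun M : Matrix (Fin n) (Fin n) ℝ => M.adjugate := by
  refine contDiff_matrix_iff.2 fun i j => ?_
  simp only [Matrix.adjugate_apply]
  refine contDiff_matrix_det.comp (contDiff_matrix_iff.2 fun k l => ?_)
  simp only [Matrix.updateRow_apply]
  split_ifs
  · exact contDiff_const
  · exact contDiff_matrix_apply _ _

theorem contDiffOn_matrix_inv :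
    ContDiffOn ℝ ∞ (fun M : Matrix (Fin n) (Fin n) ℝ => M⁻¹) {M | M.det ≠ 0} := by
  simp only [Matrix.inv_def, Ring.inverse_eq_inv']
  exact (contDiff_matrix_det.contDiffOn.inv fun M hM => hM).smul contDiff_matrix_adjugate.contDiffOn

theorem ContDiffOn.matrixInv {f : X → Matrix (Fin n) (Fin n) ℝ} {s : Set X}
    (hf : ContDiffOn ℝ ∞ f s) (h : ∀ x ∈ s, (f x).det ≠ 0) :
    ContDiffOn ℝ ∞ (fun x => (f x)⁻¹) s :=
  contDiffOn_matrix_inv.comp hf h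

theorem LinearMap.contDiff_matrix (l : Matrix (Fin n) (Fin n) ℝ →ₗ[ℝ] Matrix (Fin n) (Fin n) ℝ) :
    ContDiff ℝ ∞ l :=
  (LinearMap.toContinuousLinearMap l).contDiff

theorem LinearMap.hasDerivAt_matrix
    (l : Matrix (Fin n) (Fin n) ℝ →ₗ[ℝ] Matrix (Fin n) (Fin n) ℝ)
    {f : ℝ → Matrix (Fin n) (Fin n) ℝ} {f' : Matrix (Fin n) (Fin n) ℝ} {t : ℝ}
    (hf : HasDerivAt f f' t) : HasDerivAt (fun t => l (f t)) (l f') t :=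
  (LinearMap.toContinuousLinearMap l).hasFDerivAt.comp_hasDerivAt t hf

theorem hasDerivAt_matrix_iff {f : ℝ → Matrix (Fin n) (Fin n) ℝ} {f' : Matrix (Fin n) (Fin n) ℝ}
    {t : ℝ} : HasDerivAt f f' t ↔ ∀ i j, HasDerivAt (fun t => f t i j) (f' i j) t := by
  refine Iff.trans (hasDerivAt_pi (E' := fun _ : Fin n => Fin n → ℝ) (φ := f) (φ' := f')) ?_
  exact forall_congr' fun i => hasDerivAt_pi

theorem HasDerivAt.matrixMul {f g : ℝ → Matrix (Fin n) (Fin n) ℝ}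
    {f' g' : Matrix (Fin n) (Fin n) ℝ} {t : ℝ} (hf : HasDerivAt f f' t) (hg : HasDerivAt g g' t) :
    HasDerivAt (fun t => f t * g t) (f' * g t + f t * g') t := by
  refine hasDerivAt_matrix_iff.2 fun i j => ?_
  simp only [Matrix.mul_apply, Matrix.add_apply, ← Finset.sum_add_distrib]
  exact HasDerivAt.fun_sum fun k _ =>
    (hasDerivAt_matrix_iff.1 hf i k).mul (hasDerivAt_matrix_iff.1 hg k j)

/-- Differentiability comes from the adjugate formula; the value of the derivative from
differentiating f f⁻¹ = 1. -/
theorem HasDerivAt.matrixInv {f : ℝ → Matrix (Fin n) (Fin n) ℝ}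
    {f' : Matrix (Fin n) (Fin n) ℝ} {t : ℝ} (hf : HasDerivAt f f' t) (h : f t = 1) :
    HasDerivAt (fun t => (f t)⁻¹) (-f') t := by
  have ho : IsOpen {M : Matrix (Fin n) (Fin n) ℝ | M.det ≠ 0} :=
    isOpen_ne.preimage contDiff_matrix_det.continuous
  have hm : f t ∈ {M : Matrix (Fin n) (Fin n) ℝ | M.det ≠ 0} := by simp [h]
  have hd : DifferentiableAt ℝ (fun M : Matrix (Fin n) (Fin n) ℝ => M⁻¹) (f t) :=
    (contDiffOn_matrix_inv.contDiffAt (ho.mem_nhds hm)).differentiableAt (by simp)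
  have hi := (hd.comp t hf.differentiableAt).hasDerivAt
  set d := _root_.deriv ((fun M : Matrix (Fin n) (Fin n) ℝ => M⁻¹) ∘ f) t
  have hi' : HasDerivAt (fun t => (f t)⁻¹) d t := hi
  have hp := hf.matrixMul hi'
  have hev : (fun t => f t * (f t)⁻¹) =ᶠ[nhds t] fun _ => 1 := by
    filter_upwards [hf.continuousAt.preimage_mem_nhds (ho.mem_nhds hm)] with u hu
    exact Matrix.mul_nonsing_inv _ (IsUnit.mk0 _ hu)
  have h0 := hp.unique ((hasDerivAt_const t (1 : Matrix (Fin n) (Fin n) ℝ)).congr_of_eventuallyEq hev)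
  rw [h, inv_one, Matrix.mul_one, Matrix.one_mul, add_comm] at h0
  rwa [eq_neg_of_add_eq_zero_left h0] at hi'

end MatrixCalculus

/-! ### Local inverses of maps tangent to the identity -/

section LocalInverse

variable {E : Type*} [NormedAddCommGroup E] [NormedSpace ℝ E]

/-- Reduces the derivative computations for matrix maps below to curves, where the product and
inverse rules apply. -/
theorem hasFDerivAt_id_of_lines {f : E → E} {x : E} (hf : DifferentiableAt ℝ f x)
    (h : ∀ y, HasDerivAt (fun t : ℝ => f (x + t • y)) y 0) :
    HasFDerivAt f (ContinuousLinearMap.id ℝ E) x := by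
  have h1 : fderiv ℝ f x = ContinuousLinearMap.id ℝ E := by
    ext y
    have hl : HasDerivAt (fun t : ℝ => x + t • y) y 0 := by
      simpa using ((hasDerivAt_id (0 : ℝ)).smul_const y).const_add x
    have hx : HasFDerivAt f (fderiv ℝ f x) (x + (0 : ℝ) • y) := by simpa using hf.hasFDerivAt
    exact (hx.comp_hasDerivAt (0 : ℝ) hl).unique (h y)
  rw [← h1]
  exact hf.hasFDerivAt

theorem HasFDerivAt.id_comp_hasDerivAt {f : E → E} {x : E}
    (h : HasFDerivAt f (ContinuousLinearMap.id ℝ E) x) {c : ℝ → E} {c' : E}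
    (hc : HasDerivAt c c' 0) (h0 : c 0 = x) : HasDerivAt (fun t => f (c t)) c' 0 := by
  subst h0
  exact h.comp_hasDerivAt (0 : ℝ) hc

/-- A smooth map whose derivative at `x` is the identity restricts to a diffeomorphism between
neighbourhoods of `x` and of its image. -/
theorem exists_openPartialHomeomorph_of_hasFDerivAt_id [CompleteSpace E] {f : E → E} {x : E}
    {O : Set E} (hO : IsOpen O) (hx : x ∈ O) (hf : ContDiffOn ℝ ∞ f O)
    (h : HasFDerivAt f (ContinuousLinearMap.id ℝ E) x) :
    ∃ Φ : OpenPartialHomeomorph E E, (Φ : E → E) = f ∧ x ∈ Φ.source ∧ Φ.source ⊆ O ∧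
      ContDiffOn ℝ ∞ Φ Φ.source ∧ ContDiffOn ℝ ∞ Φ.symm Φ.target ∧
      HasFDerivAt Φ.symm (ContinuousLinearMap.id ℝ E) (f x) := by
  have hne : (∞ : WithTop ℕ∞) ≠ 0 := by simp
  have h' : HasFDerivAt f ((ContinuousLinearEquiv.refl ℝ E : E ≃L[ℝ] E) : E →L[ℝ] E) x := h
  have hfx : ContDiffAt ℝ ∞ f x := hf.contDiffAt (hO.mem_nhds hx)
  set Ψ := hfx.toOpenPartialHomeomorph f h' hne with hΨ
  have hcont : ContinuousOn (fun y => fderiv ℝ f y) O :=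
    hf.continuousOn_fderiv_of_isOpen hO (by simp)
  set R : Set (E →L[ℝ] E) := Set.range ((↑) : (E ≃L[ℝ] E) → E →L[ℝ] E) with hR
  have hRo : IsOpen R := ContinuousLinearEquiv.isOpen
  -- Restricting to points with invertible derivative makes the inverse smooth on the whole target,
  -- not only near the image of x.
  have hO1 : IsOpen (O ∩ (fun y => fderiv ℝ f y) ⁻¹' R) := hcont.isOpen_inter_preimage hO hRo
  have hx1 : x ∈ O ∩ (fun y => fderiv ℝ f y) ⁻¹' R :=
    ⟨hx, ⟨ContinuousLinearEquiv.refl ℝ E, h'.fderiv.symm⟩⟩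
  set Φ := Ψ.restrOpen _ hO1 with hΦ
  have hcoe : (Φ : E → E) = f := rfl
  have hsrc : Φ.source = Ψ.source ∩ (O ∩ (fun y => fderiv ℝ f y) ⁻¹' R) := by
    rw [hΦ, OpenPartialHomeomorph.restrOpen_source]
  have hxs : x ∈ Φ.source := by
    rw [hsrc]; exact ⟨hfx.mem_toOpenPartialHomeomorph_source h' hne, hx1⟩
  have hss : Φ.source ⊆ O := by rw [hsrc]; exact fun y hy => hy.2.1
  refine ⟨Φ, hcoe, hxs, hss, ?_, ?_, ?_⟩
  · rw [hcoe]; exact hf.mono hss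
  · intro y hy
    have hy' := Φ.map_target hy
    have hyO : Φ.symm y ∈ O := hss hy'
    rw [hsrc] at hy'
    obtain ⟨e, he⟩ := hy'.2.2
    have hfy : ContDiffAt ℝ ∞ f (Φ.symm y) := hf.contDiffAt (hO.mem_nhds hyO)
    have hd : HasFDerivAt Φ (e : E →L[ℝ] E) (Φ.symm y) := by
      rw [hcoe, he]
      exact (hfy.differentiableAt hne).hasFDerivAt
    exact (Φ.contDiffAt_symm hy hd (by rw [hcoe]; exact hfy)).contDiffWithinAt
  · have hm : f x ∈ Φ.target := Φ.map_source hxs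
    have hs : Φ.symm (f x) = x := Φ.left_inv hxs
    exact Φ.hasFDerivAt_symm (f' := ContinuousLinearEquiv.refl ℝ E) hm (by rw [hs]; exact h')

end LocalInverse

/-! ### Involutive signed permutation matrices -/

section SignedPerm

variable {n : ℕ} {v : Equiv.Perm (Fin n)} {ε : Fin n → ℤˣ}

theorem signedPerm_mul_apply (v : Equiv.Perm (Fin n)) (ε : Fin n → ℤˣ)
    (X : Matrix (Fin n) (Fin n) ℝ) (i j : Fin n) :
    (X * signedPerm v ε) i j = X i (v j) * ((ε j : ℤ) : ℝ) := by
  simp [Matrix.mul_apply, signedPerm]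

theorem perm_apply_apply (hv : signedPerm v ε * signedPerm v ε = 1) (i : Fin n) :
    v (v i) = i := by
  have h := congrFun (congrFun hv i) i
  rw [signedPerm_mul_apply, Matrix.one_apply_eq] at h
  by_contra hne
  have h0 : signedPerm v ε i (v i) = 0 := by
    simp only [signedPerm, Matrix.of_apply]
    exact if_neg fun h => hne h.symm
  rw [h0, zero_mul] at h
  exact zero_ne_one h

theorem unit_apply_apply (hv : signedPerm v ε * signedPerm v ε = 1) (i : Fin n) :
    (((ε (v i) : ℤ) : ℝ)) = ((ε i : ℤ) : ℝ) := by
  have h := congrFun (congrFun hv i) i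
  rw [signedPerm_mul_apply, Matrix.one_apply_eq] at h
  simp only [signedPerm, Matrix.of_apply, perm_apply_apply hv, if_true] at h
  rcases Int.units_eq_one_or (ε i) with h1 | h1 <;> rcases Int.units_eq_one_or (ε (v i)) with h2 | h2
    <;> simp_all

theorem unit_mul_self (ε : Fin n → ℤˣ) (i : Fin n) : ((ε i : ℤ) : ℝ) * ((ε i : ℤ) : ℝ) = 1 := by
  rcases Int.units_eq_one_or (ε i) with h1 | h1 <;> simp [h1]

theorem transpose_signedPerm (hv : signedPerm v ε * signedPerm v ε = 1) :
    (signedPerm v ε)ᵀ = signedPerm v ε := by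
  ext i j
  simp only [Matrix.transpose_apply, signedPerm, Matrix.of_apply]
  by_cases h : j = v i
  · subst h
    rw [if_pos rfl, if_pos (perm_apply_apply hv i).symm, unit_apply_apply hv]
  · rw [if_neg h, if_neg]
    rintro rfl
    exact h (perm_apply_apply hv j).symm

theorem signedPerm_inv (hv : signedPerm v ε * signedPerm v ε = 1) :
    (signedPerm v ε)⁻¹ = signedPerm v ε :=
  Matrix.inv_eq_left_inv hv

theorem signedPerm_mul_cancel (hv : signedPerm v ε * signedPerm v ε = 1)
    (X : Matrix (Fin n) (Fin n) ℝ) : signedPerm v ε * (signedPerm v ε * X) = X := by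
  rw [← Matrix.mul_assoc, hv, Matrix.one_mul]

theorem signedPerm_conj_apply (hv : signedPerm v ε * signedPerm v ε = 1)
    (X : Matrix (Fin n) (Fin n) ℝ) (i j : Fin n) :
    (signedPerm v ε * X * signedPerm v ε) i j =
      ((ε i : ℤ) : ℝ) * X (v i) (v j) * ((ε j : ℤ) : ℝ) := by
  rw [signedPerm_mul_apply, ← Matrix.transpose_apply (_ * X), Matrix.transpose_mul,
    transpose_signedPerm hv, signedPerm_mul_apply, Matrix.transpose_apply,
    mul_comm (X _ _)]

theorem signedPerm_mem_grassm (hv : signedPerm v ε * signedPerm v ε = 1) :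
    signedPerm v ε ∈ grassm n :=
  ⟨by rw [transpose_signedPerm hv, hv], hv⟩

/-- The linear anti-involution `X ↦ ṽ Xᵀ ṽ`. -/
def twist (v : Equiv.Perm (Fin n)) (ε : Fin n → ℤˣ) :
    Matrix (Fin n) (Fin n) ℝ →ₗ[ℝ] Matrix (Fin n) (Fin n) ℝ where
  toFun X := signedPerm v ε * Xᵀ * signedPerm v ε
  map_add' X Y := by rw [Matrix.transpose_add, mul_add, add_mul]
  map_smul' r X := by simp

theorem twist_def (v : Equiv.Perm (Fin n)) (ε : Fin n → ℤˣ) (X : Matrix (Fin n) (Fin n) ℝ) :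
    twist v ε X = signedPerm v ε * Xᵀ * signedPerm v ε := rfl

theorem twist_apply (hv : signedPerm v ε * signedPerm v ε = 1) (X : Matrix (Fin n) (Fin n) ℝ)
    (i j : Fin n) :
    twist v ε X i j = ((ε i : ℤ) : ℝ) * X (v j) (v i) * ((ε j : ℤ) : ℝ) := by
  rw [twist_def, signedPerm_conj_apply hv, Matrix.transpose_apply]

theorem twist_one (hv : signedPerm v ε * signedPerm v ε = 1) : twist v ε 1 = 1 := by
  rw [twist_def, Matrix.transpose_one, Matrix.mul_one, hv]

theorem twist_mul (hv : signedPerm v ε * signedPerm v ε = 1) (X Y : Matrix (Fin n) (Fin n) ℝ) :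
    twist v ε (X * Y) = twist v ε Y * twist v ε X := by
  simp only [twist_def, Matrix.transpose_mul, Matrix.mul_assoc]
  rw [signedPerm_mul_cancel hv]

theorem twist_transpose (hv : signedPerm v ε * signedPerm v ε = 1)
    (X : Matrix (Fin n) (Fin n) ℝ) : twist v ε Xᵀ = (twist v ε X)ᵀ := by
  simp only [twist_def, Matrix.transpose_mul, transpose_signedPerm hv, Matrix.mul_assoc,
    Matrix.transpose_transpose]

theorem twist_twist (hv : signedPerm v ε * signedPerm v ε = 1)
    (X : Matrix (Fin n) (Fin n) ℝ) : twist v ε (twist v ε X) = X := by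
  simp only [twist_def, Matrix.transpose_mul, transpose_signedPerm hv, Matrix.transpose_transpose,
    Matrix.mul_assoc, signedPerm_mul_cancel hv, hv, Matrix.mul_one]

end SignedPerm

/-! ### Matrices supported on a set of positions -/

section Mask

variable {n : ℕ} {v : Equiv.Perm (Fin n)} {ε : Fin n → ℤˣ}

open Classical in
/-- The part of a matrix supported on the positions `P`. -/
def mask (P : Fin n → Fin n → Prop) : Matrix (Fin n) (Fin n) ℝ →ₗ[ℝ] Matrix (Fin n) (Fin n) ℝ where
  toFun X := Matrix.of fun i j => if P i j then X i j else 0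
  map_add' X Y := by ext i j; by_cases h : P i j <;> simp [h]
  map_smul' r X := by ext i j; by_cases h : P i j <;> simp [h]

open Classical in
theorem mask_apply (P : Fin n → Fin n → Prop) (X : Matrix (Fin n) (Fin n) ℝ) (i j : Fin n) :
    mask P X i j = if P i j then X i j else 0 := rfl

theorem mask_apply_of {P : Fin n → Fin n → Prop} (X : Matrix (Fin n) (Fin n) ℝ) {i j : Fin n}
    (h : P i j) : mask P X i j = X i j := by rw [mask_apply, if_pos h]

theorem mask_apply_of_not {P : Fin n → Fin n → Prop} (X : Matrix (Fin n) (Fin n) ℝ) {i j : Fin n}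
    (h : ¬ P i j) : mask P X i j = 0 := by rw [mask_apply, if_neg h]

theorem mask_mask (P : Fin n → Fin n → Prop) (X : Matrix (Fin n) (Fin n) ℝ) :
    mask P (mask P X) = mask P X := by
  ext i j; by_cases h : P i j <;> simp [mask_apply, h]

theorem twist_mask (hv : signedPerm v ε * signedPerm v ε = 1) {P Q : Fin n → Fin n → Prop}
    (hPQ : ∀ i j, P (v j) (v i) ↔ Q i j) (X : Matrix (Fin n) (Fin n) ℝ) :
    twist v ε (mask P X) = mask Q (twist v ε X) := by
  ext i j
  rw [twist_apply hv]
  by_cases h : Q i j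
  · rw [mask_apply_of _ ((hPQ i j).2 h), mask_apply_of _ h, twist_apply hv]
  · rw [mask_apply_of_not _ (fun hh => h ((hPQ i j).1 hh)), mask_apply_of_not _ h]; simp

/-- The positions below the diagonal which are inversions of `v`. -/
def lowerInversion (v : Equiv.Perm (Fin n)) (i j : Fin n) : Prop := j < i ∧ v i < v j

/-- The positions below the diagonal which are no inversions of `v`. -/
def lowerNoninversion (v : Equiv.Perm (Fin n)) (i j : Fin n) : Prop := j < i ∧ v j < v i

/-- The positions above the diagonal which are no inversions of `v`. -/
def upperNoninversion (v : Equiv.Perm (Fin n)) (i j : Fin n) : Prop := i < j ∧ v i < v j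

/-- The positions on the diagonal and those above it which are inversions of `v`. -/
def upperInversion (v : Equiv.Perm (Fin n)) (i j : Fin n) : Prop := i ≤ j ∧ v j ≤ v i

/-- Off the diagonal, comparing i with j and v i with v j gives four exclusive cases; the diagonal
is counted in `upperInversion`. -/
theorem mask_sum (v : Equiv.Perm (Fin n)) (X : Matrix (Fin n) (Fin n) ℝ) :
    mask (upperInversion v) X + mask (lowerNoninversion v) X + mask (lowerInversion v) X +
      mask (upperNoninversion v) X = X := by
  ext i j
  simp only [Matrix.add_apply, mask_apply, upperInversion, lowerNoninversion, lowerInversion,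
    upperNoninversion]
  have hinj : v i = v j ↔ i = j := v.injective.eq_iff
  rcases lt_trichotomy i j with h | h | h
  · rcases lt_trichotomy (v i) (v j) with h' | h' | h'
    · simp [h.not_gt, h'.not_ge, h.le, h, h']
    · exact absurd (hinj.1 h') h.ne
    · simp [h.not_gt, h'.le, h.le, h'.not_gt]
  · simp [h]
  · rcases lt_trichotomy (v i) (v j) with h' | h' | h'
    · simp [h.not_ge, h.not_gt, h, h', h'.not_gt]
    · exact absurd (hinj.1 h') h.ne'
    · simp [h.not_ge, h.not_gt, h, h', h'.not_gt]

/-- The twist moves positions by (i, j) ↦ (v j, v i). As v is an involution, this interchanges the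
two inequalities defining a lower inversion. -/
theorem twist_mask_lowerInversion (hv : signedPerm v ε * signedPerm v ε = 1)
    (X : Matrix (Fin n) (Fin n) ℝ) :
    twist v ε (mask (lowerInversion v) X) = mask (lowerInversion v) (twist v ε X) :=
  twist_mask hv (fun i j => by simp [lowerInversion, perm_apply_apply hv, and_comm]) X

theorem twist_mask_upperInversion (hv : signedPerm v ε * signedPerm v ε = 1)
    (X : Matrix (Fin n) (Fin n) ℝ) :
    twist v ε (mask (upperInversion v) X) = mask (upperInversion v) (twist v ε X) :=
  twist_mask hv (fun i j => by simp [upperInversion, perm_apply_apply hv, and_comm]) X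

theorem twist_mask_lowerNoninversion (hv : signedPerm v ε * signedPerm v ε = 1)
    (X : Matrix (Fin n) (Fin n) ℝ) :
    twist v ε (mask (lowerNoninversion v) X) = mask (upperNoninversion v) (twist v ε X) :=
  twist_mask hv (fun i j => by
    simp [lowerNoninversion, upperNoninversion, perm_apply_apply hv, and_comm]) X

end Mask

/-! ### The Cholesky factor near the identity -/

section LocalCholesky

variable {n : ℕ}

/-- The upper triangular part of a matrix, with the diagonal divided by two. -/
def halfUpper : Matrix (Fin n) (Fin n) ℝ →ₗ[ℝ] Matrix (Fin n) (Fin n) ℝ where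
  toFun X := Matrix.of fun i j => if i < j then X i j else if i = j then X i j / 2 else 0
  map_add' X Y := by
    ext i j
    simp only [Matrix.of_apply, Matrix.add_apply]
    split_ifs <;> ring
  map_smul' r X := by
    ext i j
    simp only [Matrix.of_apply, Matrix.smul_apply, smul_eq_mul, RingHom.id_apply]
    split_ifs <;> ring

theorem halfUpper_apply (X : Matrix (Fin n) (Fin n) ℝ) (i j : Fin n) :
    halfUpper X i j = if i < j then X i j else if i = j then X i j / 2 else 0 := rfl

theorem halfUpper_add_transpose {X : Matrix (Fin n) (Fin n) ℝ} (hX : Xᵀ = X) :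
    halfUpper X + (halfUpper X)ᵀ = X := by
  ext i j
  simp only [Matrix.add_apply, Matrix.transpose_apply, halfUpper_apply]
  have h := congrFun (congrFun hX i) j
  rw [Matrix.transpose_apply] at h
  rcases lt_trichotomy i j with hij | rfl | hij
  · simp [hij, hij.not_gt, hij.ne']
  · simp
  · simp [hij, hij.not_gt, hij.ne', h]

theorem hasDerivAt_line (x y : Matrix (Fin n) (Fin n) ℝ) :
    HasDerivAt (fun t : ℝ => x + t • y) y 0 := by
  have h := ((hasDerivAt_id (0 : ℝ)).smul_const y).const_add x
  rwa [one_smul] at h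

/-- Near the identity the Cholesky factor is the restriction of a smooth map. -/
theorem exists_smooth_cholesky (n : ℕ) :
    ∃ (O : Set (Matrix (Fin n) (Fin n) ℝ)) (u : Matrix (Fin n) (Fin n) ℝ → Matrix (Fin n) (Fin n) ℝ),
      IsOpen O ∧ 1 ∈ O ∧ ContDiffOn ℝ ∞ u O ∧ u 1 = 1 ∧ (∀ M ∈ O, u M ∈ upperBPos n) ∧
      (∀ M ∈ O, Mᵀ = M → (u M)ᵀ * u M = M) ∧
      ∀ (c : ℝ → Matrix (Fin n) (Fin n) ℝ) (c' : Matrix (Fin n) (Fin n) ℝ), HasDerivAt c c' 0 →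
        c 0 = 1 → HasDerivAt (fun t => u (c t)) (halfUpper c') 0 := by
  have : CompleteSpace (Matrix (Fin n) (Fin n) ℝ) := FiniteDimensional.complete ℝ _
  -- For symmetric X and U = `halfUpper X` this is (1 + U)ᵀ(1 + U). Writing X in place of U + Uᵀ
  -- gives a map on all matrices with identity derivative at 0.
  set f : Matrix (Fin n) (Fin n) ℝ → Matrix (Fin n) (Fin n) ℝ :=
    fun X => 1 + X + (halfUpper X)ᵀ * halfUpper X with hf
  have hU : ContDiff ℝ ∞ (halfUpper : Matrix (Fin n) (Fin n) ℝ → _) :=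
    LinearMap.contDiff_matrix halfUpper
  have hUt : ContDiff ℝ ∞ fun X : Matrix (Fin n) (Fin n) ℝ => (halfUpper X)ᵀ :=
    contDiff_matrix_iff.2 fun i j => contDiff_matrix_iff.1 hU j i
  have hfs : ContDiff ℝ ∞ f := (contDiff_const.add contDiff_id).add (hUt.matrixMul hU)
  have hf0 : f 0 = 1 := by simp [hf]
  have hd : HasFDerivAt f (ContinuousLinearMap.id ℝ _) 0 := by
    refine hasFDerivAt_id_of_lines (hfs.differentiable (by simp) 0) fun y => ?_
    have h1 := hasDerivAt_line 0 y
    have h2 := halfUpper.hasDerivAt_matrix h1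
    have h3 : HasDerivAt (fun t : ℝ => (halfUpper (0 + t • y))ᵀ) (halfUpper y)ᵀ 0 :=
      hasDerivAt_matrix_iff.2 fun i j => hasDerivAt_matrix_iff.1 h2 j i
    have h4 := (h1.const_add (1 : Matrix (Fin n) (Fin n) ℝ)).add (h3.matrixMul h2)
    exact h4.congr_deriv (by simp)
  obtain ⟨Φ, hcoe, h0, -, -, hsymm, hds⟩ :=
    exists_openPartialHomeomorph_of_hasFDerivAt_id isOpen_univ (Set.mem_univ 0) hfs.contDiffOn hd
  rw [hf0] at hds
  have h1t : (1 : Matrix (Fin n) (Fin n) ℝ) ∈ Φ.target := by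
    rw [← hf0, ← hcoe]; exact Φ.map_source h0
  have hs1 : Φ.symm 1 = 0 := by
    rw [← hf0, ← hcoe]; exact Φ.left_inv h0
  set u : Matrix (Fin n) (Fin n) ℝ → Matrix (Fin n) (Fin n) ℝ :=
    fun M => 1 + halfUpper (Φ.symm M) with hu
  have hus : ContDiffOn ℝ ∞ u Φ.target := contDiffOn_const.add (hU.comp_contDiffOn hsymm)
  have hu1 : u 1 = 1 := by simp [hu, hs1]
  have hO' : IsOpen {M : Matrix (Fin n) (Fin n) ℝ | ∀ i, 0 < M i i} := by
    simp only [Set.ofPred_forall]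
    exact isOpen_iInter_of_finite fun i =>
      isOpen_lt continuous_const (contDiff_matrix_apply i i).continuous
  refine ⟨Φ.target ∩ u ⁻¹' {M | ∀ i, 0 < M i i}, u,
    hus.continuousOn.isOpen_inter_preimage Φ.open_target hO', ⟨h1t, by simp [hu1]⟩,
    hus.mono Set.inter_subset_left, hu1, ?_, ?_, ?_⟩
  · rintro M ⟨-, hM⟩
    refine ⟨fun i j hij => ?_, hM⟩
    simp [hu, halfUpper_apply, hij.not_gt, hij.ne', Matrix.one_apply_ne hij.ne']
  · rintro M ⟨hM, -⟩ hMt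
    have hr : f (Φ.symm M) = M := by rw [← hcoe]; exact Φ.right_inv hM
    set X := Φ.symm M with hX
    have hXe : X = M - 1 - (halfUpper X)ᵀ * halfUpper X := by
      rw [← hr]; simp only [hf]; abel
    -- The correction UᵀU is always symmetric, so X inherits the symmetry of M.
    have hXt : Xᵀ = X := by
      conv_lhs => rw [hXe]
      conv_rhs => rw [hXe]
      simp [hMt]
    have hs := halfUpper_add_transpose hXt
    calc (u M)ᵀ * u M = 1 + (halfUpper X + (halfUpper X)ᵀ) + (halfUpper X)ᵀ * halfUpper X := by
          simp only [hu, ← hX, Matrix.transpose_add, Matrix.transpose_one, add_mul, mul_add,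
            Matrix.one_mul, Matrix.mul_one]
          abel
      _ = M := by rw [hs]; exact hr
  · intro c c' hc h0
    exact (halfUpper.hasDerivAt_matrix (hds.id_comp_hasDerivAt hc h0)).const_add 1

end LocalCholesky

/-! ### Coordinates transverse to the opposite Bruhat cell -/

section CellCoordinates

variable {n : ℕ} {v : Equiv.Perm (Fin n)} {ε : Fin n → ℤˣ}

theorem diagonal_mem_upperB (ε : Fin n → ℤˣ) :
    Matrix.diagonal (fun i => ((ε i : ℤ) : ℝ)) ∈ upperB n := by
  refine ⟨fun i j h => Matrix.diagonal_apply_ne _ h.ne', ?_⟩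
  rw [Matrix.det_diagonal]
  refine IsUnit.mk0 _ (Finset.prod_ne_zero_iff.2 fun i _ h => ?_)
  have := unit_mul_self ε i
  rw [h] at this
  norm_num at this

theorem signedPerm_eq_permMat_mul (v : Equiv.Perm (Fin n)) (ε : Fin n → ℤˣ) :
    signedPerm v ε = permMat v * Matrix.diagonal (fun i => ((ε i : ℤ) : ℝ)) := by
  ext i j
  rw [Matrix.mul_diagonal]
  by_cases h : i = v j <;> simp [permMat, signedPerm, h]

theorem mem_oppBruhat_iff {g : Matrix (Fin n) (Fin n) ℝ} :
    g ∈ oppBruhat v ↔ ∃ b ∈ upperB n, ∃ c ∈ upperB n, g = bᵀ * signedPerm v ε * c := by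
  have hD := diagonal_mem_upperB ε
  constructor
  · rintro ⟨b, hb, c, hc, rfl⟩
    refine ⟨b, hb, _, mul_mem_upperB (inv_mem_upperB hD) hc, ?_⟩
    rw [signedPerm_eq_permMat_mul, ← Matrix.mul_assoc, ← Matrix.mul_assoc, Matrix.mul_assoc _ _ (_⁻¹),
      Matrix.mul_nonsing_inv _ hD.2, Matrix.mul_one]
  · rintro ⟨b, hb, c, hc, rfl⟩
    refine ⟨b, hb, _, mul_mem_upperB hD hc, ?_⟩
    rw [signedPerm_eq_permMat_mul]
    simp only [Matrix.mul_assoc]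

/-- The matrices `1 + c` with `c` supported on the inversions below the diagonal meet
`(ṽ B* ṽ) B` only in `1`. -/
theorem eq_zero_of_twist_mul_eq (hv : signedPerm v ε * signedPerm v ε = 1)
    {b u c : Matrix (Fin n) (Fin n) ℝ} (hb : b ∈ upperB n) (hu : u ∈ upperB n)
    (hc : mask (lowerInversion v) c = c) (h : twist v ε b * u = 1 + c) : c = 0 := by
  have hc0 : ∀ i j, ¬ lowerInversion v i j → c i j = 0 := fun i j hij => by
    rw [← hc, mask_apply_of_not _ hij]
  set L := twist v ε b with hL
  have hL0 : ∀ i j, v i < v j → L i j = 0 := fun i j hij => by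
    rw [hL, twist_apply hv, hb.1 _ _ hij]; simp
  -- Induction over columns: once the earlier columns of L vanish below the diagonal, entry (k, j)
  -- of the equation reads L k j * u j j = c k j. The left side vanishes if v k < v j, the right
  -- side otherwise.
  have key : ∀ j k, j < k → c k j = 0 ∧ L k j = 0 := by
    intro j
    induction j using WellFoundedLT.induction with
    | ind j ih =>
      intro k hk
      have h1 : L k j * u j j = c k j := by
        have h2 := congrFun (congrFun h k) j
        rw [Matrix.add_apply, Matrix.one_apply_ne hk.ne', zero_add, Matrix.mul_apply,
          Finset.sum_eq_single j] at h2
        · exact h2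
        · intro l _ hl
          rcases lt_or_gt_of_ne hl with hl | hl
          · rw [(ih l hl k (hl.trans hk)).2, zero_mul]
          · rw [hu.1 l j hl, mul_zero]
        · simp
      by_cases hkj : v k < v j
      · rw [hL0 k j hkj, zero_mul] at h1
        exact ⟨h1.symm, hL0 k j hkj⟩
      · have hz := hc0 k j fun hh => hkj hh.2
        rw [hz] at h1
        exact ⟨hz, (mul_eq_zero.1 h1).resolve_right (diag_ne_zero_of_mem_upperB hu j)⟩
  ext k j
  by_cases hkj : j < k
  · exact (key j k hkj).1
  · exact hc0 k j fun hh => hkj hh.1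

/-- `ṽ (ṽ b ṽ)ᵀ (1 + c) u` lies in the opposite Bruhat cell of `ṽ` iff `c = 0`. -/
theorem mem_oppBruhat_iff_eq_zero (hv : signedPerm v ε * signedPerm v ε = 1)
    {b u c : Matrix (Fin n) (Fin n) ℝ} (hb : b ∈ upperB n) (hu : u ∈ upperB n)
    (hc : mask (lowerInversion v) c = c) :
    signedPerm v ε * (twist v ε b * (1 + c) * u) ∈ oppBruhat v ↔ c = 0 := by
  set s := signedPerm v ε with hs
  have hbt : IsUnit bᵀ.det := by rw [Matrix.det_transpose]; exact hb.2
  constructor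
  · intro h
    obtain ⟨x, hx, y, hy, hxy⟩ := (mem_oppBruhat_iff (ε := ε)).1 h
    refine eq_zero_of_twist_mul_eq hv (mul_mem_upperB hx (inv_mem_upperB hb))
      (mul_mem_upperB hy (inv_mem_upperB hu)) hc ?_
    have h1 : bᵀ * s * (1 + c) * u = xᵀ * s * y := by
      rw [← hxy, twist_def, ← hs]
      simp only [Matrix.mul_assoc]
      rw [signedPerm_mul_cancel hv]
    have h2 : (bᵀ)⁻¹ * (bᵀ * s * (1 + c) * u) * u⁻¹ = s * (1 + c) := by
      simp only [Matrix.mul_assoc]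
      rw [Matrix.mul_nonsing_inv _ hu.2, Matrix.mul_one, ← Matrix.mul_assoc,
        Matrix.nonsing_inv_mul _ hbt, Matrix.one_mul]
    calc twist v ε (x * b⁻¹) * (y * u⁻¹) = s * ((bᵀ)⁻¹ * (xᵀ * s * y) * u⁻¹) := by
          rw [twist_def, Matrix.transpose_mul, Matrix.transpose_nonsing_inv, ← hs]
          simp only [Matrix.mul_assoc]
      _ = 1 + c := by rw [← h1, h2, signedPerm_mul_cancel hv]
  · rintro rfl
    refine (mem_oppBruhat_iff (ε := ε)).2 ⟨b, hb, u, hu, ?_⟩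
    rw [twist_def, ← hs, add_zero, Matrix.mul_one]
    simp only [Matrix.mul_assoc]
    rw [signedPerm_mul_cancel hv]

/-- Near the identity there is a smooth map which vanishes exactly at the matrices `h` with `ṽ h`
in the opposite Bruhat cell of `ṽ`, and which commutes with the twist on its fixed points. -/
theorem exists_cell_coordinates (hv : signedPerm v ε * signedPerm v ε = 1) :
    ∃ (O : Set (Matrix (Fin n) (Fin n) ℝ)) (κ : Matrix (Fin n) (Fin n) ℝ → Matrix (Fin n) (Fin n) ℝ),
      IsOpen O ∧ 1 ∈ O ∧ ContDiffOn ℝ ∞ κ O ∧ κ 1 = 0 ∧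
      (∀ h, mask (lowerInversion v) (κ h) = κ h) ∧
      (∀ h ∈ O, signedPerm v ε * h ∈ oppBruhat v ↔ κ h = 0) ∧
      (∀ h ∈ O, twist v ε h = h → twist v ε (κ h) = κ h) ∧
      ∀ (c : ℝ → Matrix (Fin n) (Fin n) ℝ) (c' : Matrix (Fin n) (Fin n) ℝ), HasDerivAt c c' 0 →
        c 0 = 1 → HasDerivAt (fun t => κ (c t)) (mask (lowerInversion v) c') 0 := by
  have : CompleteSpace (Matrix (Fin n) (Fin n) ℝ) := FiniteDimensional.complete ℝ _
  -- The groups ṽB*ṽ and B overlap in the diagonal and the upper inversions. Sharing these entries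
  -- equally between a and b makes the twist exchange a and b, so that f commutes with the twist.
  set p₀ : Matrix (Fin n) (Fin n) ℝ →ₗ[ℝ] _ := (1 / 2 : ℝ) • mask (upperInversion v) with hp₀
  set pl := lowerNoninversion v |> mask with hpl
  set pu := upperNoninversion v |> mask with hpu
  set pc := lowerInversion v |> mask with hpc
  set a : Matrix (Fin n) (Fin n) ℝ → Matrix (Fin n) (Fin n) ℝ := fun X => 1 + (p₀ + pl) X with ha
  set b : Matrix (Fin n) (Fin n) ℝ → Matrix (Fin n) (Fin n) ℝ := fun X => 1 + (p₀ + pu) X with hb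
  set f : Matrix (Fin n) (Fin n) ℝ → Matrix (Fin n) (Fin n) ℝ :=
    fun X => a X * (1 + pc X) * b X with hf
  have hsum : ∀ X, (p₀ + pl) X + pc X + (p₀ + pu) X = X := fun X => by
    refine Eq.trans ?_ (mask_sum v X)
    simp only [hp₀, LinearMap.add_apply, LinearMap.smul_apply, hpl, hpu, hpc]
    module
  have ha_s : ContDiff ℝ ∞ a := contDiff_const.add (LinearMap.contDiff_matrix _)
  have hb_s : ContDiff ℝ ∞ b := contDiff_const.add (LinearMap.contDiff_matrix _)
  have hfs : ContDiff ℝ ∞ f :=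
    (ha_s.matrixMul (contDiff_const.add (LinearMap.contDiff_matrix _))).matrixMul hb_s
  have hf0 : f 0 = 1 := by simp [hf, ha, hb]
  have hd : HasFDerivAt f (ContinuousLinearMap.id ℝ _) 0 := by
    refine hasFDerivAt_id_of_lines (hfs.differentiable (by simp) 0) fun y => ?_
    have h1 := hasDerivAt_line 0 y
    have h2 := ((p₀ + pl).hasDerivAt_matrix h1).const_add 1
    have h3 := (pc.hasDerivAt_matrix h1).const_add 1
    have h4 := ((p₀ + pu).hasDerivAt_matrix h1).const_add 1
    refine ((h2.matrixMul h3).matrixMul h4).congr_deriv ?_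
    simp only [zero_smul, add_zero, map_zero, Matrix.mul_one, Matrix.one_mul]
    exact hsum y
  have htw_a : ∀ X, twist v ε (a X) = b (twist v ε X) := fun X => by
    simp only [ha, hb, map_add, twist_one hv, LinearMap.add_apply, hp₀, LinearMap.smul_apply,
      map_smul, hpl, hpu, twist_mask_upperInversion hv, twist_mask_lowerNoninversion hv]
  have htw_b : ∀ X, twist v ε (b X) = a (twist v ε X) := fun X => by
    rw [← twist_twist hv (a _), htw_a, twist_twist hv]
  have htw_f : ∀ X, twist v ε (f X) = f (twist v ε X) := fun X => by
    simp only [hf, twist_mul hv, htw_a, htw_b, map_add, twist_one hv, hpc,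
      twist_mask_lowerInversion hv, Matrix.mul_assoc]
  have ha_l : ∀ X, (∀ i, 0 < (a X) i i) → twist v ε (a X) ∈ upperB n := fun X hX => by
    refine upperBPos_subset_upperB ⟨fun i j hij => ?_, fun i => ?_⟩
    · rw [htw_a]
      simp only [hb, hp₀, hpu, LinearMap.add_apply, LinearMap.smul_apply, Matrix.add_apply,
        Matrix.smul_apply, Matrix.one_apply_ne hij.ne']
      rw [mask_apply_of_not _ fun h => h.1.not_gt hij, mask_apply_of_not _ fun h => h.1.not_gt hij]
      simp
    · rw [twist_apply hv, mul_right_comm, unit_mul_self, one_mul]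
      exact hX _
  have hb_u : ∀ X, (∀ i, 0 < (b X) i i) → b X ∈ upperB n := fun X hX => by
    refine upperBPos_subset_upperB ⟨fun i j hij => ?_, hX⟩
    simp only [hb, hp₀, hpu, LinearMap.add_apply, LinearMap.smul_apply, Matrix.add_apply,
      Matrix.smul_apply, Matrix.one_apply_ne hij.ne']
    rw [mask_apply_of_not _ fun h => h.1.not_gt hij, mask_apply_of_not _ fun h => h.1.not_gt hij]
    simp
  obtain ⟨Φ, hcoe, h0, -, -, hsymm, hds⟩ :=
    exists_openPartialHomeomorph_of_hasFDerivAt_id isOpen_univ (Set.mem_univ 0) hfs.contDiffOn hd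
  rw [hf0] at hds
  have h1t : (1 : Matrix (Fin n) (Fin n) ℝ) ∈ Φ.target := by
    rw [← hf0, ← hcoe]; exact Φ.map_source h0
  have hs1 : Φ.symm 1 = 0 := by
    rw [← hf0, ← hcoe]; exact Φ.left_inv h0
  have hO' : IsOpen {M : Matrix (Fin n) (Fin n) ℝ | ∀ i, 0 < M i i} := by
    simp only [Set.ofPred_forall]
    exact isOpen_iInter_of_finite fun i =>
      isOpen_lt continuous_const (contDiff_matrix_apply i i).continuous
  -- Positive diagonals keep both triangular factors invertible. The last condition puts X and its
  -- twist in the source of Φ, where injectivity shows that X is fixed by the twist if f X is.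
  set N : Set (Matrix (Fin n) (Fin n) ℝ) := a ⁻¹' {M | ∀ i, 0 < M i i} ∩
    (b ⁻¹' {M | ∀ i, 0 < M i i} ∩ twist v ε ⁻¹' Φ.source) with hN
  have hNo : IsOpen N := (hO'.preimage ha_s.continuous).inter ((hO'.preimage hb_s.continuous).inter
    (Φ.open_source.preimage (LinearMap.contDiff_matrix (twist v ε)).continuous))
  have h0N : (0 : Matrix (Fin n) (Fin n) ℝ) ∈ N :=
    ⟨by simp [ha], by simp [hb], by simpa using h0⟩
  refine ⟨Φ.target ∩ Φ.symm ⁻¹' N, fun h => pc (Φ.symm h),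
    Φ.symm.continuousOn.isOpen_inter_preimage Φ.open_target hNo, ⟨h1t, by
      rw [Set.mem_preimage, hs1]; exact h0N⟩,
    ((LinearMap.contDiff_matrix pc).comp_contDiffOn hsymm).mono Set.inter_subset_left,
    by simp [hs1], fun h => mask_mask _ _, ?_, ?_, ?_⟩
  · rintro h ⟨hh, hX⟩
    have hr : f (Φ.symm h) = h := by rw [← hcoe]; exact Φ.right_inv hh
    have := mem_oppBruhat_iff_eq_zero hv (ha_l _ hX.1) (hb_u _ hX.2.1)
      (mask_mask (lowerInversion v) (Φ.symm h))
    rw [twist_twist hv] at this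
    rw [← this]
    change _ ↔ signedPerm v ε * f (Φ.symm h) ∈ _
    rw [hr]
  · rintro h ⟨hh, hX⟩ hth
    have hr : f (Φ.symm h) = h := by rw [← hcoe]; exact Φ.right_inv hh
    have hfix : twist v ε (Φ.symm h) = Φ.symm h := by
      refine Φ.injOn hX.2.2 (Φ.map_target hh) ?_
      rw [hcoe, ← htw_f, hr, hth]
    rw [hpc, twist_mask_lowerInversion hv, hfix]
  · intro c c' hc h0
    exact pc.hasDerivAt_matrix (hds.id_comp_hasDerivAt hc h0)

end CellCoordinates

/-! ### Tangent spaces -/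

section Tangent

variable {n : ℕ} {v : Equiv.Perm (Fin n)} {ε : Fin n → ℤˣ}

/-- The map `c ↦ c - cᵀ`. -/
def skewPart : Matrix (Fin n) (Fin n) ℝ →ₗ[ℝ] Matrix (Fin n) (Fin n) ℝ where
  toFun c := c - cᵀ
  map_add' c d := by rw [Matrix.transpose_add]; abel
  map_smul' r c := by simp [smul_sub]

/-- The map `c ↦ c + cᵀ`. -/
def symPart : Matrix (Fin n) (Fin n) ℝ →ₗ[ℝ] Matrix (Fin n) (Fin n) ℝ where
  toFun c := c + cᵀ
  map_add' c d := by rw [Matrix.transpose_add]; abel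
  map_smul' r c := by simp

theorem skewPart_apply (c : Matrix (Fin n) (Fin n) ℝ) : skewPart c = c - cᵀ := rfl

theorem symPart_apply (c : Matrix (Fin n) (Fin n) ℝ) : symPart c = c + cᵀ := rfl

/-- The tangent space of the Grassmannian at `ṽ`, multiplied by `ṽ`. -/
def grassmTangent (v : Equiv.Perm (Fin n)) (ε : Fin n → ℤˣ) :
    Submodule ℝ (Matrix (Fin n) (Fin n) ℝ) where
  carrier := {Y | Yᵀ = -Y ∧ twist v ε Y = Y}
  add_mem' {X Y} hX hY := ⟨by rw [Matrix.transpose_add, hX.1, hY.1, neg_add],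
    by rw [map_add, hX.2, hY.2]⟩
  zero_mem' := ⟨by simp, by simp⟩
  smul_mem' r X hX := ⟨by rw [Matrix.transpose_smul, hX.1, smul_neg], by rw [map_smul, hX.2]⟩

theorem mem_grassmTangent {Y : Matrix (Fin n) (Fin n) ℝ} :
    Y ∈ grassmTangent v ε ↔ Yᵀ = -Y ∧ twist v ε Y = Y := Iff.rfl

/-- The tangent space of the slice at `ṽ`, multiplied by `ṽ`. -/
def sliceTangent (v : Equiv.Perm (Fin n)) (ε : Fin n → ℤˣ) :
    Submodule ℝ (Matrix (Fin n) (Fin n) ℝ) :=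
  grassmTangent v ε ⊓ LinearMap.ker (mask (lowerInversion v))

theorem mem_sliceTangent {Y : Matrix (Fin n) (Fin n) ℝ} :
    Y ∈ sliceTangent v ε ↔ Y ∈ grassmTangent v ε ∧ mask (lowerInversion v) Y = 0 := Iff.rfl

/-- The matrices supported on the inversions below the diagonal and fixed by the twist. -/
def inversionSpace (v : Equiv.Perm (Fin n)) (ε : Fin n → ℤˣ) :
    Submodule ℝ (Matrix (Fin n) (Fin n) ℝ) where
  carrier := {c | mask (lowerInversion v) c = c ∧ twist v ε c = c}
  add_mem' {X Y} hX hY := ⟨by rw [map_add, hX.1, hY.1], by rw [map_add, hX.2, hY.2]⟩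
  zero_mem' := ⟨by simp, by simp⟩
  smul_mem' r X hX := ⟨by rw [map_smul, hX.1], by rw [map_smul, hX.2]⟩

/-- The tangent space of `𝔄_ṽ` at `1`. -/
def formTangent (v : Equiv.Perm (Fin n)) (ε : Fin n → ℤˣ) :
    Submodule ℝ (Matrix (Fin n) (Fin n) ℝ) :=
  (inversionSpace v ε).map symPart

/-- The projection onto the tangent space of the Grassmannian. -/
def tangentProj (v : Equiv.Perm (Fin n)) (ε : Fin n → ℤˣ) :
    Matrix (Fin n) (Fin n) ℝ →ₗ[ℝ] Matrix (Fin n) (Fin n) ℝ :=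
  (1 / 4 : ℝ) • (skewPart + twist v ε ∘ₗ skewPart)

theorem tangentProj_mem (hv : signedPerm v ε * signedPerm v ε = 1)
    (Y : Matrix (Fin n) (Fin n) ℝ) : tangentProj v ε Y ∈ grassmTangent v ε := by
  refine Submodule.smul_mem _ _ ⟨?_, ?_⟩
  · simp only [LinearMap.add_apply, LinearMap.comp_apply, Matrix.transpose_add, ← twist_transpose hv]
    rw [show (skewPart Y)ᵀ = -skewPart Y by simp [skewPart_apply], map_neg, neg_add]
  · simp only [LinearMap.add_apply, LinearMap.comp_apply, map_add, twist_twist hv]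
    rw [add_comm]

/-- On the tangent space `skewPart` doubles and the twist is trivial, so the two terms add up to 4Y;
this is the origin of the factor 1/4. -/
theorem tangentProj_eq {Y : Matrix (Fin n) (Fin n) ℝ} (hY : Y ∈ grassmTangent v ε) :
    tangentProj v ε Y = Y := by
  simp only [tangentProj, LinearMap.smul_apply, LinearMap.add_apply, LinearMap.comp_apply,
    skewPart_apply, hY.1, map_sub, map_neg, hY.2]
  module

theorem mask_lowerInversion_transpose {c : Matrix (Fin n) (Fin n) ℝ}
    (hc : mask (lowerInversion v) c = c) : mask (lowerInversion v) cᵀ = 0 := by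
  ext i j
  by_cases h : lowerInversion v i j
  · rw [mask_apply_of _ h, Matrix.transpose_apply, ← hc,
      mask_apply_of_not _ fun h' => h'.1.not_gt h.1]
    rfl
  · rw [mask_apply_of_not _ h]; rfl

theorem mask_skewPart {c : Matrix (Fin n) (Fin n) ℝ} (hc : mask (lowerInversion v) c = c) :
    mask (lowerInversion v) (skewPart c) = c := by
  rw [skewPart_apply, map_sub, hc, mask_lowerInversion_transpose hc, sub_zero]

theorem mask_symPart {c : Matrix (Fin n) (Fin n) ℝ} (hc : mask (lowerInversion v) c = c) :
    mask (lowerInversion v) (symPart c) = c := by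
  rw [symPart_apply, map_add, hc, mask_lowerInversion_transpose hc, add_zero]

/-- Here c is strictly lower triangular. This is the first-order change of the Cholesky factor in a
direction tangent to 𝔄_ṽ. -/
theorem halfUpper_symPart {c : Matrix (Fin n) (Fin n) ℝ} (hc : mask (lowerInversion v) c = c) :
    halfUpper (symPart c) = cᵀ := by
  have h0 : ∀ i j, i ≤ j → c i j = 0 := fun i j hij => by
    rw [← hc, mask_apply_of_not _ fun h => h.1.not_ge hij]
  ext i j
  simp only [halfUpper_apply, symPart_apply, Matrix.add_apply, Matrix.transpose_apply]
  rcases lt_trichotomy i j with h | rfl | h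
  · rw [if_pos h, h0 i j h.le, zero_add]
  · rw [if_neg (lt_irrefl _), if_pos rfl, h0 i i le_rfl]; norm_num
  · rw [if_neg h.not_gt, if_neg h.ne', h0 j i h.le]

theorem skewPart_mem (hv : signedPerm v ε * signedPerm v ε = 1) {c : Matrix (Fin n) (Fin n) ℝ}
    (hc : twist v ε c = c) : skewPart c ∈ grassmTangent v ε := by
  refine ⟨by simp [skewPart_apply], ?_⟩
  rw [skewPart_apply, map_sub, twist_transpose hv, hc]

theorem mask_mem_inversionSpace (hv : signedPerm v ε * signedPerm v ε = 1)
    {Y : Matrix (Fin n) (Fin n) ℝ} (hY : twist v ε Y = Y) :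
    mask (lowerInversion v) Y ∈ inversionSpace v ε :=
  ⟨mask_mask _ _, by rw [twist_mask_lowerInversion hv, hY]⟩

/-- A tangent vector of G splits as (c - cᵀ) + Z, with c its part at the lower inversions and Z
tangent to the slice. -/
theorem sub_skewPart_mem (hv : signedPerm v ε * signedPerm v ε = 1)
    {Y : Matrix (Fin n) (Fin n) ℝ} (hY : Y ∈ grassmTangent v ε) :
    Y - skewPart (mask (lowerInversion v) Y) ∈ sliceTangent v ε := by
  have hc := mask_mem_inversionSpace hv hY.2
  refine ⟨Submodule.sub_mem _ hY (skewPart_mem hv hc.2), ?_⟩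
  rw [SetLike.mem_coe, LinearMap.mem_ker, map_sub, mask_skewPart hc.1, sub_self]

/-- Both c ↦ c + cᵀ and c ↦ c - cᵀ are injective on `inversionSpace`, since masking recovers c; so
the tangent space of 𝔄_ṽ has the dimension of a complement of the slice tangent space. -/
theorem finrank_grassmTangent (hv : signedPerm v ε * signedPerm v ε = 1) :
    Module.finrank ℝ (grassmTangent v ε) =
      Module.finrank ℝ (formTangent v ε) + Module.finrank ℝ (sliceTangent v ε) := by
  have e1 : inversionSpace v ε ≃ₗ[ℝ] formTangent v ε :=
    LinearEquiv.ofBijective ((symPart.domRestrict (inversionSpace v ε)).codRestrict (formTangent v ε)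
      fun c => Submodule.mem_map_of_mem c.2) (by
      constructor
      · rintro ⟨c, hc⟩ ⟨d, hd⟩ h
        have h' : symPart c = symPart d := congrArg Subtype.val h
        have := congrArg (mask (lowerInversion v)) h'
        rw [mask_symPart hc.1, mask_symPart hd.1] at this
        exact Subtype.ext this
      · rintro ⟨_, c, hc, rfl⟩
        exact ⟨⟨c, hc⟩, rfl⟩)
  have e2 : grassmTangent v ε ≃ₗ[ℝ] inversionSpace v ε × sliceTangent v ε :=
    { toFun := fun Y => (⟨_, mask_mem_inversionSpace hv Y.2.2⟩, ⟨_, sub_skewPart_mem hv Y.2⟩)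
      map_add' := fun X Y => by
        ext : 2
        · simp
        · simp only [Submodule.coe_add, map_add, Prod.snd_add]; abel
      map_smul' := fun r X => by
        ext : 2
        · simp
        · simp only [Submodule.coe_smul, map_smul, Prod.smul_snd, RingHom.id_apply, smul_sub]
      invFun := fun p => ⟨p.2.1 + skewPart p.1.1,
        Submodule.add_mem _ p.2.2.1 (skewPart_mem hv p.1.2.2)⟩
      left_inv := fun Y => Subtype.ext (by simp)
      right_inv := fun p => by
        have h := mask_skewPart p.1.2.1
        have h' := (mem_sliceTangent.1 p.2.2).2
        ext : 2
        · simp [h, h']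
        · simp [h, h'] }
  rw [e2.finrank_eq, Module.finrank_prod, e1.finrank_eq]

end Tangent

/-! ### The Cayley transform -/

section Cayley

variable {n : ℕ} {v : Equiv.Perm (Fin n)} {ε : Fin n → ℤˣ}

theorem inv_mul_comm_of_comm {A B : Matrix (Fin n) (Fin n) ℝ} (hA : IsUnit A.det)
    (h : A * B = B * A) : A⁻¹ * B = B * A⁻¹ := by
  calc A⁻¹ * B = A⁻¹ * (B * A) * A⁻¹ := by
        rw [Matrix.mul_assoc, Matrix.mul_assoc, Matrix.mul_nonsing_inv _ hA, Matrix.mul_one]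
    _ = B * A⁻¹ := by
        rw [← h, ← Matrix.mul_assoc, Matrix.nonsing_inv_mul _ hA, Matrix.one_mul]

theorem twist_inv (hv : signedPerm v ε * signedPerm v ε = 1) {A : Matrix (Fin n) (Fin n) ℝ}
    (hA : IsUnit A.det) : twist v ε A⁻¹ = (twist v ε A)⁻¹ := by
  refine (Matrix.inv_eq_left_inv ?_).symm
  rw [← twist_mul hv, Matrix.mul_nonsing_inv _ hA, twist_one hv]

theorem det_twist (hv : signedPerm v ε * signedPerm v ε = 1) (A : Matrix (Fin n) (Fin n) ℝ) :
    (twist v ε A).det = A.det := by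
  have h := congrArg Matrix.det hv
  rw [Matrix.det_mul, Matrix.det_one] at h
  rw [twist_def, Matrix.det_mul, Matrix.det_mul, Matrix.det_transpose, mul_right_comm, h, one_mul]

/-- The Cayley transform `k ↦ k (1 + k/2)⁻¹`. -/
def cayley (k : Matrix (Fin n) (Fin n) ℝ) : Matrix (Fin n) (Fin n) ℝ :=
  k * (1 + (1 / 2 : ℝ) • k)⁻¹

/-- The map `Y ↦ (1 + Y/2) (1 - Y/2)⁻¹`, which is `1 + k` on the Cayley transform of `k`. -/
def cayleyInv (Y : Matrix (Fin n) (Fin n) ℝ) : Matrix (Fin n) (Fin n) ℝ :=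
  (1 + (1 / 2 : ℝ) • Y) * (1 - (1 / 2 : ℝ) • Y)⁻¹

theorem one_sub_cayley {k : Matrix (Fin n) (Fin n) ℝ} (hk : IsUnit (1 + (1 / 2 : ℝ) • k).det) :
    1 - (1 / 2 : ℝ) • cayley k = (1 + (1 / 2 : ℝ) • k)⁻¹ := by
  set M := 1 + (1 / 2 : ℝ) • k with hM
  have h1 : (1 : Matrix (Fin n) (Fin n) ℝ) = M * M⁻¹ := (Matrix.mul_nonsing_inv _ hk).symm
  calc 1 - (1 / 2 : ℝ) • cayley k = M * M⁻¹ - ((1 / 2 : ℝ) • k) * M⁻¹ := by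
        rw [← h1, cayley, ← hM, Matrix.smul_mul]
    _ = M⁻¹ := by rw [← sub_mul, hM]; simp

theorem cayleyInv_cayley {k : Matrix (Fin n) (Fin n) ℝ}
    (hk : IsUnit (1 + (1 / 2 : ℝ) • k).det) : cayleyInv (cayley k) = 1 + k := by
  rw [cayleyInv, one_sub_cayley hk, Matrix.nonsing_inv_nonsing_inv _ hk]
  have h1 := Matrix.nonsing_inv_mul _ hk
  have h2 : cayley k * (1 + (1 / 2 : ℝ) • k) = k := by
    rw [cayley, Matrix.mul_assoc, h1, Matrix.mul_one]
  rw [add_mul, Matrix.smul_mul, h2, Matrix.one_mul, add_assoc, ← add_smul]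
  norm_num

theorem twist_cayley (hv : signedPerm v ε * signedPerm v ε = 1) {k : Matrix (Fin n) (Fin n) ℝ}
    (hk : IsUnit (1 + (1 / 2 : ℝ) • k).det) : twist v ε (cayley k) = cayley (twist v ε k) := by
  have h : twist v ε (1 + (1 / 2 : ℝ) • k) = 1 + (1 / 2 : ℝ) • twist v ε k := by
    rw [map_add, map_smul, twist_one hv]
  rw [cayley, twist_mul hv, twist_inv hv hk, h, cayley]
  refine inv_mul_comm_of_comm (by rwa [← h, det_twist hv]) ?_
  rw [add_mul, mul_add, Matrix.one_mul, Matrix.mul_one, Matrix.smul_mul, Matrix.mul_smul]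

theorem twist_cayleyInv (hv : signedPerm v ε * signedPerm v ε = 1) {Y : Matrix (Fin n) (Fin n) ℝ}
    (hY : IsUnit (1 - (1 / 2 : ℝ) • Y).det) (h : twist v ε Y = Y) :
    twist v ε (cayleyInv Y) = cayleyInv Y := by
  rw [cayleyInv, twist_mul hv, twist_inv hv hY, map_add, map_sub, map_smul, twist_one hv, h]
  refine inv_mul_comm_of_comm hY ?_
  simp only [sub_mul, add_mul, mul_sub, mul_add, Matrix.one_mul, Matrix.mul_one]
  abel

/-- For orthogonal h, the equation (ṽh)² = 1 says ṽhṽ = h⁻¹ = hᵀ. -/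
theorem signedPerm_mul_mem_grassm_iff (hv : signedPerm v ε * signedPerm v ε = 1)
    {h : Matrix (Fin n) (Fin n) ℝ} :
    signedPerm v ε * h ∈ grassm n ↔ hᵀ * h = 1 ∧ twist v ε h = h := by
  have h1 : (signedPerm v ε * h)ᵀ * (signedPerm v ε * h) = hᵀ * h := by
    rw [Matrix.transpose_mul, transpose_signedPerm hv, Matrix.mul_assoc, signedPerm_mul_cancel hv]
  have h2 : twist v ε h = h ↔ hᵀ = signedPerm v ε * h * signedPerm v ε := by
    rw [twist_def]
    constructor
    · intro hh
      conv_rhs => rw [← hh]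
      simp only [Matrix.mul_assoc]
      rw [signedPerm_mul_cancel hv, hv, Matrix.mul_one]
    · intro hh
      rw [hh]
      simp only [Matrix.mul_assoc]
      rw [signedPerm_mul_cancel hv, hv, Matrix.mul_one]
  change (_ = _ ∧ _ = _) ↔ _
  rw [h1, h2]
  refine and_congr_right fun h3 => ?_
  rw [← Matrix.mul_assoc]
  have h4 : h * hᵀ = 1 := mul_eq_one_comm.1 h3
  constructor
  · intro h5
    calc hᵀ = signedPerm v ε * h * signedPerm v ε * h * hᵀ := by rw [h5, Matrix.one_mul]
      _ = _ := by rw [Matrix.mul_assoc, h4, Matrix.mul_one]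
  · intro h5
    rw [← h5, h3]

/-- With M = 1 + k/2 and C = `cayley k`, one has Mᵀ(Cᵀ + C)M = (1 + k)ᵀ(1 + k) - 1, so C is skew iff
1 + k is orthogonal. The transform commutes with the twist and is injective where M is invertible,
which matches the other condition. -/
theorem cayley_mem_grassmTangent_iff (hv : signedPerm v ε * signedPerm v ε = 1)
    {k : Matrix (Fin n) (Fin n) ℝ} (hk : IsUnit (1 + (1 / 2 : ℝ) • k).det) :
    cayley k ∈ grassmTangent v ε ↔ signedPerm v ε * (1 + k) ∈ grassm n := by
  rw [signedPerm_mul_mem_grassm_iff hv, mem_grassmTangent]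
  refine and_congr ?_ ?_
  · set M := 1 + (1 / 2 : ℝ) • k with hM
    have hMt : IsUnit Mᵀ.det := by rwa [Matrix.det_transpose]
    have h1 : Mᵀ * ((cayley k)ᵀ + cayley k) * M = (1 + k)ᵀ * (1 + k) - 1 := by
      have e1 : Mᵀ * (cayley k)ᵀ = kᵀ := by
        rw [← Matrix.transpose_mul, cayley, Matrix.mul_assoc, ← hM, Matrix.nonsing_inv_mul _ hk,
          Matrix.mul_one]
      have e2 : cayley k * M = k := by
        rw [cayley, Matrix.mul_assoc, ← hM, Matrix.nonsing_inv_mul _ hk, Matrix.mul_one]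
      rw [mul_add Mᵀ, add_mul (Mᵀ * _), e1, Matrix.mul_assoc, e2, hM]
      simp only [Matrix.transpose_add, Matrix.transpose_one, Matrix.transpose_smul, mul_add, add_mul,
        Matrix.one_mul, Matrix.mul_one, Matrix.mul_smul, Matrix.smul_mul]
      module
    rw [eq_neg_iff_add_eq_zero, ← sub_eq_zero (a := (1 + k)ᵀ * (1 + k)), ← h1]
    constructor
    · intro h; rw [h]; simp
    · intro h
      calc (cayley k)ᵀ + cayley k = (Mᵀ)⁻¹ * (Mᵀ * ((cayley k)ᵀ + cayley k) * M) * M⁻¹ := by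
            rw [← Matrix.mul_assoc, ← Matrix.mul_assoc, Matrix.nonsing_inv_mul _ hMt,
              Matrix.one_mul, Matrix.mul_assoc, Matrix.mul_nonsing_inv _ hk, Matrix.mul_one]
        _ = 0 := by rw [h]; simp
  · have h : twist v ε (1 + (1 / 2 : ℝ) • k) = 1 + (1 / 2 : ℝ) • twist v ε k := by
      rw [map_add, map_smul, twist_one hv]
    have hk' : IsUnit (1 + (1 / 2 : ℝ) • twist v ε k).det := by rwa [← h, det_twist hv]
    rw [twist_cayley hv hk, map_add, twist_one hv, add_right_inj]
    constructor
    · intro hh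
      have := congrArg cayleyInv hh
      rwa [cayleyInv_cayley hk, cayleyInv_cayley hk', add_right_inj] at this
    · intro hh; rw [hh]

end Cayley

/-! ### A chart flattening the Grassmannian and the slice -/

section Chart

variable {n : ℕ} {v : Equiv.Perm (Fin n)} {ε : Fin n → ℤˣ}

theorem isSubmanifoldAt_of_chart {E : Type*} [NormedAddCommGroup E] [NormedSpace ℝ E]
    {S : Set E} {x : E} {Φ : OpenPartialHomeomorph E E} {L : Submodule ℝ E} (hx : x ∈ S)
    (hxs : x ∈ Φ.source) (h1 : ContDiffOn ℝ ∞ Φ Φ.source) (h2 : ContDiffOn ℝ ∞ Φ.symm Φ.target)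
    (h : ∀ y ∈ Φ.source, y ∈ S ↔ Φ y ∈ L) : IsSubmanifoldAt S x (Module.finrank ℝ L) := by
  refine ⟨hx, Φ, L, hxs, h1, h2, rfl, ?_⟩
  ext z
  constructor
  · rintro ⟨y, ⟨hyS, hy⟩, rfl⟩
    exact ⟨(h y hy).1 hyS, Φ.map_source hy⟩
  · rintro ⟨hzL, hz⟩
    refine ⟨Φ.symm z, ⟨(h _ (Φ.map_target hz)).2 ?_, Φ.map_target hz⟩, Φ.right_inv hz⟩
    rwa [Φ.right_inv hz]

/-- Local homeomorphisms of a normed space, for the topology given by the norm. -/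
abbrev PartialChart (E : Type*) [NormedAddCommGroup E] := OpenPartialHomeomorph E E

theorem PartialChart.exists_precomp {E : Type*} [NormedAddCommGroup E] (Ψ : PartialChart E)
    {α β : E → E} (hα : Continuous α) (hβ : Continuous β) (hl : ∀ x, β (α x) = x)
    (hr : ∀ x, α (β x) = x) :
    ∃ Φ : PartialChart E, (Φ : E → E) = (fun x => Ψ (α x)) ∧
      (Φ.symm : E → E) = (fun y => β (Ψ.symm y)) ∧ Φ.source = α ⁻¹' Ψ.source ∧
      Φ.target = Ψ.target := by
  let e : E ≃ₜ E := ⟨⟨α, β, hl, hr⟩, hα, hβ⟩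
  refine ⟨e.toOpenPartialHomeomorph.trans Ψ, rfl, rfl, ?_, ?_⟩
  · rw [OpenPartialHomeomorph.trans_source]; simp [e]
  · rw [OpenPartialHomeomorph.trans_target]; simp

theorem isOpen_det_ne_zero : IsOpen {M : Matrix (Fin n) (Fin n) ℝ | M.det ≠ 0} :=
  isOpen_ne.preimage contDiff_matrix_det.continuous

theorem contDiff_one_add_smul (r : ℝ) :
    ContDiff ℝ ∞ fun k : Matrix (Fin n) (Fin n) ℝ => 1 + r • k :=
  contDiff_const.add (contDiff_id.const_smul r)

theorem hasDerivAt_cayley {c : ℝ → Matrix (Fin n) (Fin n) ℝ} {c' : Matrix (Fin n) (Fin n) ℝ}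
    (hc : HasDerivAt c c' 0) (h0 : c 0 = 0) : HasDerivAt (fun t => cayley (c t)) c' 0 := by
  have h1 : HasDerivAt (fun t => 1 + (1 / 2 : ℝ) • c t) ((1 / 2 : ℝ) • c') 0 :=
    (hc.const_smul (1 / 2 : ℝ)).const_add 1
  refine (hc.matrixMul (h1.matrixInv (by simp [h0]))).congr_deriv ?_
  simp [h0]

theorem hasDerivAt_cayleyInv {c : ℝ → Matrix (Fin n) (Fin n) ℝ} {c' : Matrix (Fin n) (Fin n) ℝ}
    (hc : HasDerivAt c c' 0) (h0 : c 0 = 0) : HasDerivAt (fun t => cayleyInv (c t)) c' 0 := by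
  have h1 : HasDerivAt (fun t => 1 + (1 / 2 : ℝ) • c t) ((1 / 2 : ℝ) • c') 0 :=
    (hc.const_smul (1 / 2 : ℝ)).const_add 1
  have h2 : HasDerivAt (fun t => 1 - (1 / 2 : ℝ) • c t) (-((1 / 2 : ℝ) • c')) 0 :=
    (hc.const_smul (1 / 2 : ℝ)).const_sub 1
  refine (h1.matrixMul (h2.matrixInv (by simp [h0]))).congr_deriv ?_
  simp only [h0, smul_zero, sub_zero, inv_one, Matrix.mul_one, add_zero, Matrix.one_mul]
  module

theorem mem_slice_iff {g : Matrix (Fin n) (Fin n) ℝ} :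
    g ∈ slice v ↔ g ∈ grassm n ∧ g ∈ oppBruhat v := Iff.rfl

/-- A map tangent to the identity at `0` which flattens the Grassmannian and the slice in the
coordinate `k = ṽ g - 1`. -/
theorem exists_flattening_map (hv : signedPerm v ε * signedPerm v ε = 1) :
    ∃ (O : Set (Matrix (Fin n) (Fin n) ℝ)) (f : Matrix (Fin n) (Fin n) ℝ → Matrix (Fin n) (Fin n) ℝ),
      IsOpen O ∧ 0 ∈ O ∧ ContDiffOn ℝ ∞ f O ∧ f 0 = 0 ∧
      HasFDerivAt f (ContinuousLinearMap.id ℝ _) 0 ∧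
      (∀ k ∈ O, signedPerm v ε * (1 + k) ∈ grassm n ↔ f k ∈ grassmTangent v ε) ∧
      (∀ k ∈ O, signedPerm v ε * (1 + k) ∈ slice v ↔ f k ∈ sliceTangent v ε) := by
  obtain ⟨Oκ, κ, hOκ, h1κ, hκs, hκ1, hκm, hκz, hκt, hκd⟩ := exists_cell_coordinates hv
  set p := tangentProj v ε with hp
  set pc := mask (lowerInversion v) with hpc
  set D₁ : Set (Matrix (Fin n) (Fin n) ℝ) :=
    (fun k => 1 + (1 / 2 : ℝ) • k) ⁻¹' {M | M.det ≠ 0} with hD₁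
  have hD₁o : IsOpen D₁ := isOpen_det_ne_zero.preimage (contDiff_one_add_smul _).continuous
  have hcs : ContDiffOn ℝ ∞ (cayley : Matrix (Fin n) (Fin n) ℝ → _) D₁ :=
    contDiffOn_id.matrixMul ((contDiff_one_add_smul _).contDiffOn.matrixInv fun k hk => hk)
  have hps : ContDiffOn ℝ ∞ (fun k => p (cayley k)) D₁ :=
    (LinearMap.contDiff_matrix p).comp_contDiffOn hcs
  have hqs : ContDiffOn ℝ ∞ (fun k => 1 - (1 / 2 : ℝ) • p (cayley k)) D₁ :=
    contDiffOn_const.sub (hps.const_smul (1 / 2 : ℝ))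
  set D₂ := D₁ ∩ (fun k => 1 - (1 / 2 : ℝ) • p (cayley k)) ⁻¹' {M | M.det ≠ 0} with hD₂
  have hD₂o : IsOpen D₂ := hqs.continuousOn.isOpen_inter_preimage hD₁o isOpen_det_ne_zero
  have hhs : ContDiffOn ℝ ∞ (fun k => cayleyInv (p (cayley k))) D₂ :=
    (contDiffOn_const.add ((hps.mono Set.inter_subset_left).const_smul (1 / 2 : ℝ))).matrixMul
      ((hqs.mono Set.inter_subset_left).matrixInv fun k hk => hk.2)
  set D₃ := D₂ ∩ (fun k => cayleyInv (p (cayley k))) ⁻¹' Oκ with hD₃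
  have hD₃o : IsOpen D₃ := hhs.continuousOn.isOpen_inter_preimage hD₂o hOκ
  have hκs' : ContDiffOn ℝ ∞ (fun k => κ (cayleyInv (p (cayley k)))) D₃ :=
    hκs.comp (hhs.mono Set.inter_subset_left) fun k hk => hk.2
  have h31 : D₃ ⊆ D₁ := fun k hk => hk.1.1
  -- The lower inversion entries of the Cayley coordinate are replaced by κ, antisymmetrized to stay
  -- tangent. Inserting p makes the argument of κ twist-fixed for every k; on G it is just 1 + k.
  set f : Matrix (Fin n) (Fin n) ℝ → Matrix (Fin n) (Fin n) ℝ :=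
    fun k => cayley k + skewPart (κ (cayleyInv (p (cayley k))) - pc (p (cayley k))) with hf
  have hfs : ContDiffOn ℝ ∞ f D₃ := (hcs.mono h31).add
    ((LinearMap.contDiff_matrix skewPart).comp_contDiffOn
      (hκs'.sub ((LinearMap.contDiff_matrix pc).comp_contDiffOn (hps.mono h31))))
  have hc0 : cayley (0 : Matrix (Fin n) (Fin n) ℝ) = 0 := by simp [cayley]
  have hi0 : cayleyInv (0 : Matrix (Fin n) (Fin n) ℝ) = 1 := by simp [cayleyInv]
  have h0 : (0 : Matrix (Fin n) (Fin n) ℝ) ∈ D₃ :=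
    ⟨⟨by simp [hD₁], by simp [hc0]⟩, by simpa [hc0, hi0] using h1κ⟩
  -- The correction term is tangent for every k, also off G.
  have hmem : ∀ k ∈ D₃, f k ∈ grassmTangent v ε ↔ cayley k ∈ grassmTangent v ε := by
    rintro k ⟨⟨hk1, hk2⟩, hk3⟩
    have ht := (tangentProj_mem hv (cayley k)).2
    refine Submodule.add_mem_iff_left _ (skewPart_mem hv ?_)
    rw [map_sub, hκt _ hk3 (twist_cayleyInv hv (IsUnit.mk0 _ hk2) ht), hpc,
      twist_mask_lowerInversion hv, ht]
  have hG : ∀ k ∈ D₃, signedPerm v ε * (1 + k) ∈ grassm n ↔ f k ∈ grassmTangent v ε :=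
    fun k hk => by
      rw [hmem k hk, cayley_mem_grassmTangent_iff hv (IsUnit.mk0 _ hk.1.1)]
  refine ⟨D₃, f, hD₃o, h0, hfs, by simp [hf, hc0, hi0, hκ1], ?_, hG, ?_⟩
  · refine hasFDerivAt_id_of_lines
      ((hfs.contDiffAt (hD₃o.mem_nhds h0)).differentiableAt (by simp)) fun y => ?_
    have e1 := hasDerivAt_cayley (hasDerivAt_line 0 y) (by simp)
    have e2 := p.hasDerivAt_matrix e1
    have e3 := hκd _ _ (hasDerivAt_cayleyInv e2 (by simp [hc0])) (by simp [hc0, hi0])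
    refine (e1.add (skewPart.hasDerivAt_matrix (e3.sub (pc.hasDerivAt_matrix e2)))).congr_deriv ?_
    simp
  · intro k hk
    rw [mem_slice_iff, mem_sliceTangent, ← hG k hk]
    refine and_congr_right fun hg => ?_
    have hk1 : IsUnit (1 + (1 / 2 : ℝ) • k).det := IsUnit.mk0 _ hk.1.1
    have hpk : p (cayley k) = cayley k :=
      tangentProj_eq ((cayley_mem_grassmTangent_iff hv hk1).2 hg)
    have hkO : 1 + k ∈ Oκ := by
      have := hk.2
      rwa [Set.mem_preimage, hpk, cayleyInv_cayley hk1] at this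
    have hfk : pc (f k) = κ (1 + k) := by
      simp only [hf]
      rw [hpk, cayleyInv_cayley hk1, map_add, mask_skewPart (by rw [map_sub, hκm, mask_mask])]
      abel
    rw [hfk, hκz _ hkO]

/-- A chart around `ṽ` flattening both the Grassmannian and the slice. -/
theorem exists_chart (hv : signedPerm v ε * signedPerm v ε = 1) :
    ∃ Φ : PartialChart (Matrix (Fin n) (Fin n) ℝ),
      signedPerm v ε ∈ Φ.source ∧ ContDiffOn ℝ ∞ Φ Φ.source ∧ ContDiffOn ℝ ∞ Φ.symm Φ.target ∧
      Φ (signedPerm v ε) = 0 ∧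
      (∀ g ∈ Φ.source, g ∈ grassm n ↔ Φ g ∈ grassmTangent v ε) ∧
      (∀ g ∈ Φ.source, g ∈ slice v ↔ Φ g ∈ sliceTangent v ε) ∧
      (∀ (c : ℝ → Matrix (Fin n) (Fin n) ℝ) (c' : Matrix (Fin n) (Fin n) ℝ), HasDerivAt c c' 0 →
        c 0 = signedPerm v ε → HasDerivAt (fun t => Φ (c t)) (signedPerm v ε * c') 0) ∧
      ∀ (c : ℝ → Matrix (Fin n) (Fin n) ℝ) (c' : Matrix (Fin n) (Fin n) ℝ), HasDerivAt c c' 0 →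
        c 0 = 0 → HasDerivAt (fun t => Φ.symm (c t)) (signedPerm v ε * c') 0 := by
  have : CompleteSpace (Matrix (Fin n) (Fin n) ℝ) := FiniteDimensional.complete ℝ _
  obtain ⟨O, f, hO, h0O, hfs, hf0, hfd, hG, hS⟩ := exists_flattening_map hv
  obtain ⟨Ψ, hcoe, h0, hsub, hΨs, hΨi, hds⟩ :=
    exists_openPartialHomeomorph_of_hasFDerivAt_id hO h0O hfs hfd
  set s := signedPerm v ε with hs
  have hss : s * s - 1 = 0 := by rw [hv, sub_self]
  have hback : ∀ g, s * (1 + (s * g - 1)) = g := fun g => by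
    rw [add_sub_cancel, signedPerm_mul_cancel hv]
  have hl : ContDiff ℝ ∞ fun g => s * g - 1 :=
    (contDiff_const.matrixMul contDiff_id).sub contDiff_const
  have hl' : ContDiff ℝ ∞ fun k => s * (1 + k) :=
    contDiff_const.matrixMul (contDiff_const.add contDiff_id)
  obtain ⟨Φ, hΦ, hΦi, hsrc, htgt⟩ := PartialChart.exists_precomp Ψ hl.continuous hl'.continuous hback
    fun k => by rw [signedPerm_mul_cancel hv, add_sub_cancel_left]
  rw [hcoe] at hΦ
  have hsrc' : ∀ g ∈ Φ.source, s * g - 1 ∈ O := fun g hg => by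
    rw [hsrc] at hg; exact hsub hg
  refine ⟨Φ, by rw [hsrc, Set.mem_preimage, hss]; exact h0, ?_, ?_, by simp [hΦ, hss, hf0], ?_, ?_, ?_, ?_⟩
  · rw [hΦ]
    exact hfs.comp hl.contDiffOn hsrc'
  · rw [hΦi, htgt]
    exact contDiffOn_const.matrixMul (contDiffOn_const.add hΨi)
  · intro g hg
    rw [hΦ, ← hG _ (hsrc' g hg), hback]
  · intro g hg
    rw [hΦ, ← hS _ (hsrc' g hg), hback]
  · intro c c' hc hc0
    rw [hΦ]
    refine hfd.id_comp_hasDerivAt (((hasDerivAt_const (0 : ℝ) s).matrixMul hc).sub_const 1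
      |>.congr_deriv ?_) ?_
    · simp
    · simp [hc0, hss]
  · intro c c' hc hc0
    rw [hΦi]
    rw [hf0] at hds
    have h1 := hds.id_comp_hasDerivAt hc hc0
    refine ((hasDerivAt_const (0 : ℝ) s).matrixMul (h1.const_add 1)).congr_deriv ?_
    simp

end Chart

/-! ### The normalized forms and the local formula for `chi` -/

section Forms

variable {n : ℕ} {v : Equiv.Perm (Fin n)} {ε : Fin n → ℤˣ}

theorem posDef_of_eq_transpose_mul_self {A u : Matrix (Fin n) (Fin n) ℝ} (hu : u ∈ upperBPos n)
    (h : uᵀ * u = A) : A.PosDef := by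
  rw [← h, ← Matrix.conjTranspose_eq_transpose_of_trivial]
  refine Matrix.PosDef.conjTranspose_mul_self u ?_
  exact Matrix.mulVec_injective_of_isUnit ((Matrix.isUnit_iff_isUnit_det u).2
    (isUnit_det_of_mem_upperBPos hu))

theorem transpose_eq_of_posDef {A : Matrix (Fin n) (Fin n) ℝ} (hA : A.PosDef) : Aᵀ = A := by
  rw [← Matrix.conjTranspose_eq_transpose_of_trivial]
  exact hA.isHermitian

theorem symPart_transpose (c : Matrix (Fin n) (Fin n) ℝ) : (symPart c)ᵀ = symPart c := by
  rw [symPart_apply, Matrix.transpose_add, Matrix.transpose_transpose, add_comm]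

theorem twist_symPart (hv : signedPerm v ε * signedPerm v ε = 1) {c : Matrix (Fin n) (Fin n) ℝ}
    (hc : twist v ε c = c) : twist v ε (symPart c) = symPart c := by
  rw [symPart_apply, map_add, twist_transpose hv, hc]

theorem mask_lowerInversion_one (v : Equiv.Perm (Fin n)) :
    mask (lowerInversion v) (1 : Matrix (Fin n) (Fin n) ℝ) = 0 := by
  ext i j
  by_cases h : lowerInversion v i j
  · rw [mask_apply_of _ h, Matrix.one_apply_ne h.1.ne']; rfl
  · rw [mask_apply_of_not _ h]; rfl

theorem one_add_symPart_mem_normForms (hv : signedPerm v ε * signedPerm v ε = 1)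
    {c : Matrix (Fin n) (Fin n) ℝ} (hc : c ∈ inversionSpace v ε) (hA : (1 + symPart c).PosDef) :
    1 + symPart c ∈ normForms v ε := by
  have hc0 : ∀ i j, ¬ lowerInversion v i j → c i j = 0 := fun i j hij => by
    rw [← hc.1, mask_apply_of_not _ hij]
  refine ⟨hA, ?_, fun i => ?_, fun i j hij hvij => ?_⟩
  · have h := twist_symPart hv hc.2
    rw [twist_def, symPart_transpose] at h
    rw [signedPerm_inv hv, mul_add, add_mul, Matrix.mul_one, hv, h]
  · rw [symPart_apply, Matrix.add_apply, Matrix.add_apply, Matrix.transpose_apply,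
      hc0 i i fun h => h.1.false, Matrix.one_apply_eq]
    norm_num
  · rw [symPart_apply, Matrix.add_apply, Matrix.add_apply, Matrix.transpose_apply,
      hc0 i j fun h => h.1.not_gt hij, hc0 j i fun h => h.2.not_gt hvij, Matrix.one_apply_ne hij.ne]
    norm_num

/-- By symmetry, the unit diagonal and the vanishing conditions, only the entries at lower
inversions are free; for symmetric A, invariance under ṽ is invariance under the twist. -/
theorem mask_mem_of_mem_normForms (hv : signedPerm v ε * signedPerm v ε = 1)
    {A : Matrix (Fin n) (Fin n) ℝ} (hA : A ∈ normForms v ε) :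
    mask (lowerInversion v) A ∈ inversionSpace v ε ∧
      A = 1 + symPart (mask (lowerInversion v) A) := by
  obtain ⟨hpd, hinv, hdiag, hzero⟩ := hA
  have hAt := transpose_eq_of_posDef hpd
  have hAt' : ∀ i j, A j i = A i j := fun i j => congrFun (congrFun hAt i) j
  refine ⟨mask_mem_inversionSpace hv ?_, ?_⟩
  · rw [twist_def, hAt]
    rwa [signedPerm_inv hv] at hinv
  · have key : ∀ i j, j < i →
        A i j = mask (lowerInversion v) A i j + mask (lowerInversion v) A j i := by
      intro i j hij
      rw [mask_apply_of_not (i := j) (j := i) _ fun h => h.1.not_gt hij, add_zero]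
      by_cases h : lowerInversion v i j
      · rw [mask_apply_of _ h]
      · rw [mask_apply_of_not _ h, ← hAt']
        refine hzero j i hij (lt_of_le_of_ne ?_ (v.injective.ne hij.ne))
        by_contra! h'
        exact h ⟨hij, h'⟩
    ext i j
    rw [symPart_apply, Matrix.add_apply, Matrix.add_apply, Matrix.transpose_apply]
    rcases lt_trichotomy i j with h | rfl | h
    · rw [Matrix.one_apply_ne h.ne, zero_add, ← hAt' i j, add_comm]
      exact key j i h
    · rw [mask_apply_of_not _ fun h => h.1.false, hdiag, Matrix.one_apply_eq]
      norm_num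
    · rw [Matrix.one_apply_ne h.ne', zero_add]
      exact key i j h

theorem one_mem_normForms (hv : signedPerm v ε * signedPerm v ε = 1) : 1 ∈ normForms v ε := by
  have h := one_add_symPart_mem_normForms hv (Submodule.zero_mem (inversionSpace v ε))
    (by rw [map_zero, add_zero]; exact Matrix.PosDef.one)
  rwa [map_zero, add_zero] at h

theorem signedPerm_mem_slice (hv : signedPerm v ε * signedPerm v ε = 1) :
    signedPerm v ε ∈ slice v := by
  have h1 : (1 : Matrix (Fin n) (Fin n) ℝ) ∈ upperB n :=
    ⟨fun i j h => Matrix.one_apply_ne h.ne', by simp⟩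
  exact ⟨signedPerm_mem_grassm hv, (mem_oppBruhat_iff (ε := ε)).2 ⟨1, h1, 1, h1, by simp⟩⟩

theorem isSubmanifoldAt_normForms (hv : signedPerm v ε * signedPerm v ε = 1) :
    IsSubmanifoldAt (normForms v ε) 1 (Module.finrank ℝ (formTangent v ε)) := by
  have : CompleteSpace (Matrix (Fin n) (Fin n) ℝ) := FiniteDimensional.complete ℝ _
  obtain ⟨O, u, hO, h1, -, -, hup, hchol, -⟩ := exists_smooth_cholesky n
  have hs : ContDiff ℝ ∞ fun X : Matrix (Fin n) (Fin n) ℝ => X - 1 := contDiff_id.sub contDiff_const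
  obtain ⟨Φ, hcoe, hx, hsub, h2, h3, -⟩ := exists_openPartialHomeomorph_of_hasFDerivAt_id hO h1
    hs.contDiffOn ((hasFDerivAt_id (𝕜 := ℝ) (1 : Matrix (Fin n) (Fin n) ℝ)).sub_const 1)
  refine isSubmanifoldAt_of_chart (one_mem_normForms hv) hx h2 h3 fun A hA => ?_
  rw [hcoe]
  constructor
  · intro h
    obtain ⟨hc, he⟩ := mask_mem_of_mem_normForms hv h
    exact ⟨_, hc, (sub_eq_of_eq_add' he).symm⟩
  · rintro ⟨c, hc, he⟩
    have he' : A = 1 + symPart c := by rw [he, add_sub_cancel]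
    have ht : Aᵀ = A := by rw [he', Matrix.transpose_add, symPart_transpose, Matrix.transpose_one]
    -- Positive definiteness is automatic here: symmetric matrices in the domain of the smooth
    -- Cholesky map have a Cholesky factor.
    have hpd := posDef_of_eq_transpose_mul_self (hup A (hsub hA)) (hchol A (hsub hA) ht)
    rw [he'] at hpd ⊢
    exact one_add_symPart_mem_normForms hv hc hpd

/-- The conjugate of `g` by `u ((A + g A g) / 2)`. -/
def conjMap (u : Matrix (Fin n) (Fin n) ℝ → Matrix (Fin n) (Fin n) ℝ)
    (p : Matrix (Fin n) (Fin n) ℝ × Matrix (Fin n) (Fin n) ℝ) : Matrix (Fin n) (Fin n) ℝ :=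
  u ((1 / 2 : ℝ) • (p.1 + p.2 * p.1 * p.2)) * p.2 * (u ((1 / 2 : ℝ) • (p.1 + p.2 * p.1 * p.2)))⁻¹

/-- Halving A + gAg brings its value at (1, ṽ) to 1, where the smooth Cholesky map lives; it
rescales ψ by a scalar, which conjugation does not see. -/
theorem chi_eq_conjMap {O : Set (Matrix (Fin n) (Fin n) ℝ)}
    {u : Matrix (Fin n) (Fin n) ℝ → Matrix (Fin n) (Fin n) ℝ} (hup : ∀ M ∈ O, u M ∈ upperBPos n)
    (hchol : ∀ M ∈ O, Mᵀ = M → (u M)ᵀ * u M = M) {A g : Matrix (Fin n) (Fin n) ℝ}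
    (hA : A.PosDef) (hg : g ∈ grassm n) (h : (1 / 2 : ℝ) • (A + g * A * g) ∈ O) :
    chi (A, g) = conjMap u (A, g) := by
  have hM := transpose_eq_of_posDef (posDef_add_conj hA hg)
  have h1 := hup _ h
  have h2 := hchol _ h (by rw [Matrix.transpose_smul, hM])
  have h3 := isUnit_det_of_mem_upperBPos h1
  rw [chi, conjMap]
  simp only
  set ψ := u ((1 / 2 : ℝ) • (A + g * A * g)) with hψ
  have h4 : cholesky (A + g * A * g) = Real.sqrt 2 • ψ := by
    refine cholesky_eq ⟨fun i j hij => ?_, fun i => ?_⟩ ?_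
    · rw [Matrix.smul_apply, h1.1 i j hij, smul_zero]
    · exact mul_pos (by positivity) (h1.2 i)
    · rw [Matrix.transpose_smul, Matrix.smul_mul, Matrix.mul_smul, smul_smul, h2, smul_smul,
        Real.mul_self_sqrt (by norm_num)]
      norm_num
  have h5 : (Real.sqrt 2 • ψ)⁻¹ = (Real.sqrt 2)⁻¹ • ψ⁻¹ := by
    refine Matrix.inv_eq_left_inv ?_
    rw [Matrix.smul_mul, Matrix.mul_smul, smul_smul, Matrix.nonsing_inv_mul _ h3,
      inv_mul_cancel₀ (by positivity), one_smul]
  rw [h4, h5, Matrix.smul_mul, Matrix.smul_mul, Matrix.mul_smul, smul_smul,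
    mul_inv_cancel₀ (by positivity), one_smul]

theorem contDiffOn_conjMap {O : Set (Matrix (Fin n) (Fin n) ℝ)}
    {u : Matrix (Fin n) (Fin n) ℝ → Matrix (Fin n) (Fin n) ℝ} (hu : ContDiffOn ℝ ∞ u O)
    (hup : ∀ M ∈ O, u M ∈ upperBPos n) :
    ContDiffOn ℝ ∞ (conjMap u) ((fun p : Matrix (Fin n) (Fin n) ℝ × Matrix (Fin n) (Fin n) ℝ =>
      (1 / 2 : ℝ) • (p.1 + p.2 * p.1 * p.2)) ⁻¹' O) := by
  have h1 : ContDiff ℝ ∞ fun p : Matrix (Fin n) (Fin n) ℝ × Matrix (Fin n) (Fin n) ℝ =>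
      (1 / 2 : ℝ) • (p.1 + p.2 * p.1 * p.2) :=
    (contDiff_fst.add ((contDiff_snd.matrixMul contDiff_fst).matrixMul contDiff_snd)).const_smul _
  have h2 := hu.comp h1.contDiffOn (Set.mapsTo_preimage _ O)
  exact (h2.matrixMul contDiff_snd.contDiffOn).matrixMul
    (h2.matrixInv fun p hp => (isUnit_det_of_mem_upperBPos (hup _ hp)).ne_zero)

/-- The derivative of `chi` at `(1, ṽ)` in the direction of `(c + cᵀ, ṽ Z)`. -/
theorem hasDerivAt_conjMap (hv : signedPerm v ε * signedPerm v ε = 1)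
    {u : Matrix (Fin n) (Fin n) ℝ → Matrix (Fin n) (Fin n) ℝ} (hu1 : u 1 = 1)
    (hu : ∀ (c : ℝ → Matrix (Fin n) (Fin n) ℝ) (c' : Matrix (Fin n) (Fin n) ℝ),
      HasDerivAt c c' 0 → c 0 = 1 → HasDerivAt (fun t => u (c t)) (halfUpper c') 0)
    {A g : ℝ → Matrix (Fin n) (Fin n) ℝ} {c Z : Matrix (Fin n) (Fin n) ℝ}
    (hc : c ∈ inversionSpace v ε) (hZ : Z ∈ grassmTangent v ε)
    (hA : HasDerivAt A (symPart c) 0) (hA0 : A 0 = 1)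
    (hg : HasDerivAt g (signedPerm v ε * Z) 0) (hg0 : g 0 = signedPerm v ε) :
    HasDerivAt (fun t => conjMap u (A t, g t)) (signedPerm v ε * (skewPart c + Z)) 0 := by
  set s := signedPerm v ε with hs
  have hZs : s * Z * s = -Z := by
    have h := hZ.2
    rw [twist_def, hZ.1, ← hs, mul_neg, neg_mul] at h
    rw [← h, neg_neg, h]
  have has : s * symPart c * s = symPart c := by
    have h := twist_symPart hv hc.2
    rwa [twist_def, symPart_transpose] at h
  have hcs : cᵀ * s = s * c := by
    have h := hc.2
    rw [twist_def, ← hs] at h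
    conv_rhs => rw [← h]
    rw [Matrix.mul_assoc, signedPerm_mul_cancel hv]
  -- The variation of g contributes ṽZṽ + Z = 0, and ṽ-invariance doubles the contribution of A.
  have e1 : HasDerivAt (fun t => (1 / 2 : ℝ) • (A t + g t * A t * g t)) (symPart c) 0 := by
    refine ((hA.add ((hg.matrixMul hA).matrixMul hg)).const_smul (1 / 2 : ℝ)).congr_deriv ?_
    rw [hA0, hg0, Matrix.mul_one, Matrix.mul_one, add_mul, hZs, has, signedPerm_mul_cancel hv]
    module
  have h0 : (1 / 2 : ℝ) • (A 0 + g 0 * A 0 * g 0) = 1 := by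
    rw [hA0, hg0, Matrix.mul_one, hv]
    module
  have e2 := hu _ _ e1 h0
  rw [halfUpper_symPart hc.1] at e2
  have h0' : u ((1 / 2 : ℝ) • (A 0 + g 0 * A 0 * g 0)) = 1 := by rw [h0, hu1]
  refine ((e2.matrixMul hg).matrixMul (e2.matrixInv h0')).congr_deriv ?_
  -- What remains is cᵀṽ + ṽZ - ṽcᵀ, and cᵀṽ = ṽc.
  rw [h0', hg0]
  simp only [inv_one, Matrix.mul_one, Matrix.one_mul, hcs, skewPart_apply]
  rw [mul_neg, mul_add, mul_sub]
  abel

end Forms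

/-! ### The local product decomposition -/

section Product

variable {n : ℕ} {v : Equiv.Perm (Fin n)} {ε : Fin n → ℤˣ}

theorem ContDiffOn.smoothOnSet {E F : Type*} [NormedAddCommGroup E] [NormedSpace ℝ E]
    [NormedAddCommGroup F] [NormedSpace ℝ F] {f f' : E → F} {O S : Set E}
    (h : ContDiffOn ℝ ∞ f' O) (hO : IsOpen O) (hS : S ⊆ O) (he : Set.EqOn f f' S) :
    SmoothOnSet f S :=
  fun _ hx => ⟨O, f', hO, hS hx, h, he.mono Set.inter_subset_left⟩

theorem chi_one_signedPerm (hv : signedPerm v ε * signedPerm v ε = 1) :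
    chi (1, signedPerm v ε) = signedPerm v ε := by
  obtain ⟨O, u, -, h1, -, hu1, hup, hchol, -⟩ := exists_smooth_cholesky n
  have h0 : (1 / 2 : ℝ) • (1 + signedPerm v ε * 1 * signedPerm v ε) = 1 := by
    rw [Matrix.mul_one, hv]; module
  rw [chi_eq_conjMap hup hchol Matrix.PosDef.one (signedPerm_mem_grassm hv) (by rw [h0]; exact h1),
    conjMap]
  simp only
  rw [h0, hu1, inv_one, Matrix.mul_one, Matrix.one_mul]

/-- Near `(1, ṽ)` the map `chi` restricts to a diffeomorphism of a product of neighbourhoods in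
`𝔄_ṽ` and in the slice onto a neighbourhood of `ṽ` in the Grassmannian. -/
theorem exists_product_decomposition (hv : signedPerm v ε * signedPerm v ε = 1) :
    ∃ U V W : Set (Matrix (Fin n) (Fin n) ℝ),
      IsOpenIn U (normForms v ε) ∧ 1 ∈ U ∧ IsOpenIn V (slice v) ∧ signedPerm v ε ∈ V ∧
      IsOpenIn W (grassm n) ∧ signedPerm v ε ∈ W ∧ IsDiffeoOnSet chi (U ×ˢ V) W := by
  have : CompleteSpace (Matrix (Fin n) (Fin n) ℝ) := FiniteDimensional.complete ℝ _
  obtain ⟨Oc, u, hOc, h1c, hus, hu1, hup, hchol, hud⟩ := exists_smooth_cholesky n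
  obtain ⟨Φ, hsΦ, hΦs, hΦi, hΦ0, hG, hS, hΦd, hΦid⟩ := exists_chart hv
  set s := signedPerm v ε with hs
  set p := tangentProj v ε with hp
  set pc := mask (lowerInversion v) with hpc
  have hΦsymm0 : Φ.symm 0 = s := by rw [← hΦ0]; exact Φ.left_inv hsΦ
  have h0t : (0 : Matrix (Fin n) (Fin n) ℝ) ∈ Φ.target := by rw [← hΦ0]; exact Φ.map_source hsΦ
  -- the domain on which `chi` is smooth with values in the domain of the chart
  set Ω₀ : Set (Matrix (Fin n) (Fin n) ℝ × Matrix (Fin n) (Fin n) ℝ) :=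
    (fun q => (1 / 2 : ℝ) • (q.1 + q.2 * q.1 * q.2)) ⁻¹' Oc with hΩ₀
  have hmid : Continuous fun q : Matrix (Fin n) (Fin n) ℝ × Matrix (Fin n) (Fin n) ℝ =>
      (1 / 2 : ℝ) • (q.1 + q.2 * q.1 * q.2) := by fun_prop
  have hχs : ContDiffOn ℝ ∞ (conjMap u) Ω₀ := contDiffOn_conjMap hus hup
  have hΩ₀o : IsOpen Ω₀ := hOc.preimage hmid
  set Ω := (Ω₀ ∩ conjMap u ⁻¹' Φ.source) ∩ Oc ×ˢ Φ.source with hΩ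
  have hΩo : IsOpen Ω := (hχs.continuousOn.isOpen_inter_preimage hΩ₀o Φ.open_source).inter
    (hOc.prod Φ.open_source)
  have hmid1 : (1 / 2 : ℝ) • (1 + s * 1 * s) = 1 := by rw [Matrix.mul_one, hv]; module
  have hχ1 : conjMap u (1, s) = s := by
    rw [conjMap]
    simp only
    rw [hmid1, hu1, inv_one, Matrix.mul_one, Matrix.one_mul]
  have h1Ω : (1, s) ∈ Ω := by
    refine ⟨⟨?_, by rw [Set.mem_preimage, hχ1]; exact hsΦ⟩, h1c, hsΦ⟩
    change (1 / 2 : ℝ) • (1 + s * 1 * s) ∈ Oc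
    rw [hmid1]; exact h1c
  have hpd : ∀ A ∈ Oc, Aᵀ = A → A.PosDef := fun A hA ht =>
    posDef_of_eq_transpose_mul_self (hup A hA) (hchol A hA ht)
  have hχ : ∀ A g, A.PosDef → g ∈ grassm n → (A, g) ∈ Ω → chi (A, g) = conjMap u (A, g) :=
    fun A g hA hg h => chi_eq_conjMap hup hchol hA hg h.1.1
  -- the parametrization of the product by the tangent space of the Grassmannian
  set z : Matrix (Fin n) (Fin n) ℝ →ₗ[ℝ] Matrix (Fin n) (Fin n) ℝ :=
    p - skewPart ∘ₗ pc ∘ₗ p with hz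
  set N := z ⁻¹' Φ.target with hN
  have hNo : IsOpen N := Φ.open_target.preimage (LinearMap.contDiff_matrix z).continuous
  -- For tangent Y = (c - cᵀ) + Z this is the pair (1 + c + cᵀ, `Φ.symm Z`); for general Y it
  -- depends only on p Y.
  set par : Matrix (Fin n) (Fin n) ℝ → Matrix (Fin n) (Fin n) ℝ × Matrix (Fin n) (Fin n) ℝ :=
    fun Y => (1 + (symPart ∘ₗ pc ∘ₗ p) Y, Φ.symm (z Y)) with hpar
  have hpars : ContDiffOn ℝ ∞ par N :=
    (contDiff_const.add (LinearMap.contDiff_matrix (symPart ∘ₗ pc ∘ₗ p))).contDiffOn.prodMk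
      (hΦi.comp (LinearMap.contDiff_matrix z).contDiffOn (Set.mapsTo_preimage _ _))
  have hpar0 : par 0 = (1, s) := by simp only [hpar, map_zero, add_zero, hΦsymm0]
  set D₀ := N ∩ par ⁻¹' Ω with hD₀
  have hD₀o : IsOpen D₀ := hpars.continuousOn.isOpen_inter_preimage hNo hΩo
  have h0N : (0 : Matrix (Fin n) (Fin n) ℝ) ∈ N := by rw [hN, Set.mem_preimage, map_zero]; exact h0t
  have h0D : (0 : Matrix (Fin n) (Fin n) ℝ) ∈ D₀ := ⟨h0N, by rw [Set.mem_preimage, hpar0]; exact h1Ω⟩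
  -- On the tangent space the term Y - p Y vanishes and D is χ in coordinates. Off it, that term
  -- makes the derivative at 0 the identity of the whole matrix space.
  set D : Matrix (Fin n) (Fin n) ℝ → Matrix (Fin n) (Fin n) ℝ :=
    fun Y => Y - p Y + Φ (conjMap u (par Y)) with hD
  have hDs : ContDiffOn ℝ ∞ D D₀ := by
    refine (contDiff_id.sub (LinearMap.contDiff_matrix p)).contDiffOn.add
      (hΦs.comp (hχs.comp (hpars.mono Set.inter_subset_left) ?_) ?_)
    · exact fun Y hY => hY.2.1.1
    · exact fun Y hY => hY.2.1.2
  have hD0 : D 0 = 0 := by simp only [hD, map_zero, hpar0, hχ1, hΦ0]; simp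
  have hinv : ∀ Y, pc (p Y) ∈ inversionSpace v ε := fun Y =>
    mask_mem_inversionSpace hv (tangentProj_mem hv Y).2
  have hzmem : ∀ Y, z Y ∈ sliceTangent v ε := fun Y => sub_skewPart_mem hv (tangentProj_mem hv Y)
  have hDd : HasFDerivAt D (ContinuousLinearMap.id ℝ _) 0 := by
    refine hasFDerivAt_id_of_lines
      ((hDs.contDiffAt (hD₀o.mem_nhds h0D)).differentiableAt (by simp)) fun y => ?_
    have e1 := hasDerivAt_line 0 y
    have e2 := p.hasDerivAt_matrix e1
    have e3 := ((symPart ∘ₗ pc ∘ₗ p).hasDerivAt_matrix e1).const_add 1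
    have e4 := hΦid _ _ (z.hasDerivAt_matrix e1) (by simp)
    have e5 := hΦd _ _ (hasDerivAt_conjMap hv hu1 hud (hinv y) (hzmem y).1 e3 (by simp) e4
      (by simp only [zero_smul, add_zero, map_zero]; exact hΦsymm0)) (by
        rw [show (0 : Matrix (Fin n) (Fin n) ℝ) + (0 : ℝ) • y = 0 by simp]
        exact (congrArg (conjMap u) hpar0).trans hχ1)
    refine ((e1.sub e2).add e5).congr_deriv ?_
    rw [signedPerm_mul_cancel hv]
    simp only [hz, LinearMap.sub_apply, LinearMap.comp_apply]
    abel
  obtain ⟨Ψ, hΨc, h0Ψ, hΨD, hΨs, hΨi, -⟩ :=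
    exists_openPartialHomeomorph_of_hasFDerivAt_id hD₀o h0D hDs hDd
  -- the inverse of the parametrization
  set ρ : Matrix (Fin n) (Fin n) ℝ × Matrix (Fin n) (Fin n) ℝ → Matrix (Fin n) (Fin n) ℝ :=
    fun q => skewPart (pc q.1) + Φ q.2 with hρ
  have hρs : ContDiffOn ℝ ∞ ρ Ω :=
    ((LinearMap.contDiff_matrix (skewPart ∘ₗ pc)).comp contDiff_fst).contDiffOn.add
      (hΦs.comp contDiff_snd.contDiffOn fun q hq => hq.2.2)
  have hρ1 : ρ (1, s) = 0 := by
    simp only [hρ, hpc, mask_lowerInversion_one, map_zero, hΦ0, add_zero]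
  have hΩ'o : IsOpen (Ω ∩ ρ ⁻¹' Ψ.source) :=
    hρs.continuousOn.isOpen_inter_preimage hΩo Ψ.open_source
  obtain ⟨O₁, O₂, hO₁, hO₂, h1O₁, hsO₂, hO₁₂⟩ := isOpen_prod_iff.1 hΩ'o 1 s
    ⟨h1Ω, by rw [Set.mem_preimage, hρ1]; exact h0Ψ⟩
  -- O₃ is cut out by requiring the candidate inverse k to land in O₁ × O₂, so that G ∩ O₃ is
  -- exactly the image of the product and no further shrinking is needed.
  set B₁ := N ∩ par ⁻¹' (O₁ ×ˢ O₂) with hB₁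
  have hB₁o : IsOpen B₁ := hpars.continuousOn.isOpen_inter_preimage hNo (hO₁.prod hO₂)
  set B₂ := Ψ.target ∩ Ψ.symm ⁻¹' B₁ with hB₂
  have hB₂o : IsOpen B₂ := Ψ.symm.continuousOn.isOpen_inter_preimage Ψ.open_target hB₁o
  set O₃ := Φ.source ∩ Φ ⁻¹' B₂ with hO₃
  have hO₃o : IsOpen O₃ := hΦs.continuousOn.isOpen_inter_preimage Φ.open_source hB₂o
  set k : Matrix (Fin n) (Fin n) ℝ → Matrix (Fin n) (Fin n) ℝ × Matrix (Fin n) (Fin n) ℝ :=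
    fun w => par (Ψ.symm (Φ w)) with hk
  have hks : ContDiffOn ℝ ∞ k O₃ := by
    refine hpars.comp (hΨi.comp (hΦs.mono Set.inter_subset_left) ?_) ?_
    · exact fun w hw => hw.2.1
    · exact fun w hw => hw.2.2.1
  have hforward : ∀ A ∈ normForms v ε ∩ O₁, ∀ g ∈ slice v ∩ O₂,
      chi (A, g) ∈ grassm n ∩ O₃ ∧ k (chi (A, g)) = (A, g) := by
    rintro A ⟨hA, hAO⟩ g ⟨hg, hgO⟩
    have hq := hO₁₂ (Set.mk_mem_prod hAO hgO)
    obtain ⟨hc, hAe⟩ := mask_mem_of_mem_normForms hv hA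
    have hgs : g ∈ Φ.source := hq.1.2.2
    have hΦg := (hS g hgs).1 hg
    have hχe := hχ A g hA.1 hg.1 hq.1
    have hYT : ρ (A, g) ∈ grassmTangent v ε :=
      Submodule.add_mem _ (skewPart_mem hv hc.2) hΦg.1
    have hpY : p (ρ (A, g)) = ρ (A, g) := tangentProj_eq hYT
    have hpcY : pc (ρ (A, g)) = pc A := by
      rw [hpc, map_add, mask_skewPart hc.1, (mem_sliceTangent.1 hΦg).2, add_zero]
    have hzY : z (ρ (A, g)) = Φ g := by
      simp only [hz, LinearMap.sub_apply, LinearMap.comp_apply, hpY, hpcY]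
      exact add_sub_cancel_left _ _
    have hparY : par (ρ (A, g)) = (A, g) := by
      simp only [hpar, LinearMap.comp_apply, hpY, hpcY, hzY]
      rw [← hAe, Φ.left_inv hgs]
    have hDY : Ψ (ρ (A, g)) = Φ (chi (A, g)) := by
      rw [hΨc, hχe]
      simp only [hD]
      rw [hpY, hparY, sub_self, zero_add]
    have hsy : Ψ.symm (Φ (chi (A, g))) = ρ (A, g) := by rw [← hDY, Ψ.left_inv hq.2]
    refine ⟨⟨chi_mem_grassm hA.1 hg.1, by rw [hχe]; exact hq.1.1.2, ?_, ?_⟩, ?_⟩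
    · rw [← hDY]; exact Ψ.map_source hq.2
    · rw [Set.mem_preimage, hsy]
      refine ⟨(hΨD hq.2).1, ?_⟩
      rw [Set.mem_preimage, hparY]
      exact ⟨hAO, hgO⟩
    · simp only [hk]
      rw [hsy, hparY]
  have hbackward : ∀ w ∈ grassm n ∩ O₃,
      k w ∈ (normForms v ε ∩ O₁) ×ˢ (slice v ∩ O₂) ∧ chi (k w) = w := by
    rintro w ⟨hw, hws, hwt, hwN, hwO⟩
    set Y := Ψ.symm (Φ w) with hY
    have hYD : Y ∈ D₀ := hΨD (Ψ.map_target hwt)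
    have hΩY : par Y ∈ Ω := hYD.2
    have hA : (par Y).1 ∈ normForms v ε := by
      refine one_add_symPart_mem_normForms hv (hinv Y) (hpd _ hΩY.2.1 ?_)
      simp only [LinearMap.comp_apply, Matrix.transpose_add, symPart_transpose,
        Matrix.transpose_one]
    have hg : (par Y).2 ∈ slice v := by
      rw [hS _ hΩY.2.2]
      simp only [hpar]
      rw [Φ.right_inv hYD.1]
      exact hzmem Y
    have hχe := hχ _ _ hA.1 hg.1 hΩY
    have hχG : conjMap u (par Y) ∈ grassm n := by rw [← hχe]; exact chi_mem_grassm hA.1 hg.1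
    have hDY : D Y = Φ w := by rw [← hΨc]; exact Ψ.right_inv hwt
    have hYe : Y = D Y - Φ (conjMap u (par Y)) + p Y := by simp only [hD]; abel
    -- Both w and χ(par Y) lie in G, so their coordinates are tangent; the definition of D then
    -- forces Y to be tangent as well.
    have hYT : Y ∈ grassmTangent v ε := by
      rw [hYe, hDY]
      exact Submodule.add_mem _ (Submodule.sub_mem _ ((hG w hws).1 hw)
        ((hG _ hΩY.1.2).1 hχG)) (tangentProj_mem hv Y)
    have hΦe : Φ (conjMap u (par Y)) = Φ w := by
      rw [← hDY]
      simp only [hD]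
      rw [tangentProj_eq hYT, sub_self, zero_add]
    refine ⟨⟨⟨hA, hwO.1⟩, hg, hwO.2⟩, hχe.trans (Φ.injOn hΩY.1.2 hws hΦe)⟩
  have hs1 := hforward 1 ⟨one_mem_normForms hv, h1O₁⟩ s ⟨signedPerm_mem_slice hv, hsO₂⟩
  rw [chi_one_signedPerm hv] at hs1
  refine ⟨normForms v ε ∩ O₁, slice v ∩ O₂, grassm n ∩ O₃, ⟨O₁, hO₁, rfl⟩,
    ⟨one_mem_normForms hv, h1O₁⟩, ⟨O₂, hO₂, rfl⟩, ⟨signedPerm_mem_slice hv, hsO₂⟩,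
    ⟨O₃, hO₃o, rfl⟩, hs1.1, ?_⟩
  have hinvOn : Set.InvOn k chi ((normForms v ε ∩ O₁) ×ˢ (slice v ∩ O₂)) (grassm n ∩ O₃) :=
    ⟨fun q hq => (hforward q.1 hq.1 q.2 hq.2).2, fun w hw => (hbackward w hw).2⟩
  refine ⟨hinvOn.bijOn (fun q hq => (hforward q.1 hq.1 q.2 hq.2).1) fun w hw => (hbackward w hw).1,
    hχs.smoothOnSet hΩ₀o (fun q hq => (hO₁₂ ⟨hq.1.2, hq.2.2⟩).1.1.1) fun q hq => ?_,
    k, hinvOn, hks.smoothOnSet hO₃o Set.inter_subset_right fun _ _ => rfl⟩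
  exact hχ q.1 q.2 hq.1.1.1 hq.2.1.1 (hO₁₂ ⟨hq.1.2, hq.2.2⟩).1

end Product

end

/-! ### The local product decomposition and its compatibility with the Bruhat cells -/

theorem mainTheorem6 (n : ℕ) (v : Equiv.Perm (Fin n)) (ε : Fin n → ℤˣ)
    (hv : signedPerm v ε * signedPerm v ε = 1) :
    -- `χ` is well defined on `𝔄_ṽ × G`, has values in `G`, and is the map `(α, g) ↦ π(α g α⁻¹)`
    -- on the Cholesky factors `α` of the elements of `𝔄_ṽ`
    (∀ A ∈ normForms v ε, ∀ g ∈ grassm n,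
      (∃! ψ, ψ ∈ upperBPos n ∧ ψᵀ * ψ = A + g * A * g) ∧
      (∃! α, α ∈ upperBPos n ∧ αᵀ * α = A) ∧
      chi (A, g) = orthoProj (cholesky A * g * (cholesky A)⁻¹) ∧
      chi (A, g) ∈ grassm n) ∧
    -- near the base points the three spaces are manifolds, the two factors having
    -- complementary dimensions
    (∃ a b : ℕ, IsSubmanifoldAt (normForms v ε) 1 a ∧
      IsSubmanifoldAt (slice v) (signedPerm v ε) b ∧
      IsSubmanifoldAt (grassm n) (signedPerm v ε) (a + b)) ∧
    -- `χ` is a local diffeomorphism near `(1, ṽ)`, onto a neighbourhood of `ṽ` in `G`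
    chi (1, signedPerm v ε) = signedPerm v ε ∧
    ∃ U V W : Set (Matrix (Fin n) (Fin n) ℝ),
      IsOpenIn U (normForms v ε) ∧ 1 ∈ U ∧
      IsOpenIn V (slice v) ∧ signedPerm v ε ∈ V ∧
      IsOpenIn W (grassm n) ∧ signedPerm v ε ∈ W ∧
      IsDiffeoOnSet chi (U ×ˢ V) W ∧
      -- the product decomposition is compatible with the Bruhat cells and their closures
      (∀ w : Equiv.Perm (Fin n),
        chi '' (U ×ˢ (V ∩ bruhat w)) = W ∩ bruhat w ∧
        chi '' (U ×ˢ (V ∩ closure (bruhat w))) = W ∩ closure (bruhat w)) ∧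
      (∀ (w : Equiv.Perm (Fin n)) (δ : Fin n → ℤˣ),
        chi '' (U ×ˢ (V ∩ signedBruhat w δ)) = W ∩ signedBruhat w δ ∧
        chi '' (U ×ˢ (V ∩ closure (signedBruhat w δ))) = W ∩ closure (signedBruhat w δ)) := by
  have hpd : ∀ A ∈ normForms v ε, A.PosDef := fun A hA => hA.1
  obtain ⟨U, V, W, hU, h1U, hV, hsV, hW, hsW, hdiff⟩ := exists_product_decomposition hv
  have hUpd : ∀ A ∈ U, A.PosDef := by
    obtain ⟨O, -, rfl⟩ := hU
    exact fun A hA => hpd A hA.1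
  have hVG : V ⊆ grassm n := by
    obtain ⟨O, -, rfl⟩ := hV
    exact fun g hg => hg.1.1
  have key : ∀ C : Set (Matrix (Fin n) (Fin n) ℝ), IsConjStable C →
      chi '' (U ×ˢ (V ∩ C)) = W ∩ C ∧ chi '' (U ×ˢ (V ∩ closure C)) = W ∩ closure C := fun C hC =>
    ⟨chi_image_inter hC hUpd hVG hdiff.1.image_eq,
      chi_image_inter hC.closure hUpd hVG hdiff.1.image_eq⟩
  refine ⟨fun A hA g hg => ⟨existsUnique_cholesky (posDef_add_conj (hpd A hA) hg),
    existsUnique_cholesky (hpd A hA), chi_eq_orthoProj (hpd A hA) hg, chi_mem_grassm (hpd A hA) hg⟩,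
    ⟨_, Module.finrank ℝ (sliceTangent v ε), isSubmanifoldAt_normForms hv, ?_, ?_⟩, chi_one_signedPerm hv, U, V, W, hU, h1U, hV, hsV,
    hW, hsW, hdiff, fun w => key _ (isConjStable_bruhat w),
    fun w δ => key _ (isConjStable_signedBruhat w δ)⟩
  · obtain ⟨Φ, hs, h1, h2, -, -, hS, -⟩ := exists_chart hv
    exact isSubmanifoldAt_of_chart (signedPerm_mem_slice hv) hs h1 h2 hS
  · obtain ⟨Φ, hs, h1, h2, -, hG, -⟩ := exists_chart hv
    rw [← finrank_grassmTangent hv]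
    exact isSubmanifoldAt_of_chart (signedPerm_mem_grassm hv) hs h1 h2 hG
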